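/- Let $\xi(s)=\pi^{-s/2}(s-1)\Gamma\left(1+\frac s2\right)\zeta(s)$ be the Riemann $\xi$-function (an entire function after removal of the removable singularities of this formula) and let $\Xi(s)=\xi\left(\frac12+is\right)$. For $u\ge 0$ put $$\Phi(u)=\sum_{n=1}^{\infty}\left(4n^{4}\pi^{2}e^{9u/2}-6n^{2}\pi e^{5u/2}\right)e^{-n^{2}\pi e^{2u}},$$ and for $n,k\in\mathbb N_0=\{0,1,2,\dots\}$ put $$a_n=\frac{2}{(2n)!}\int_0^\infty \Phi(u)u^{2n}\,du,\qquad m_k=-\frac{1}{(2k+3)!\cdot 2}\left(\frac{\Xi'}{\Xi}\right)^{(2k+3)}(0).$$ Then $a_n>0$ for all $n\in\mathbb N_0$, and $\xi\left(\frac12+s\right)=\sum_{n=0}^\infty a_n s^{2n}$ for all $s\in\mathbb C$. For every $n\in\mathbb N_0$: 1. $m_n=(-1)^n\det M_n$, where $M_n=(M_{ij})_{0\le i,j\le n}$ is the $(n+1)\times(n+1)$ matrix whose last column has the entries $M_{in}=\frac{a_1a_{i+1}}{a_0^2}-\frac{(i+2)a_{i+2}}{a_0}$, and whose other columns ($0\le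 j<n$) have the entries $M_{ij}=\frac{a_{i-j}}{a_0}$ for $j<i$, $M_{jj}=1$, and $M_{ij}=0$ for $j>i$; 2. $\displaystyle (-1)^n m_n=\frac{a_1a_{n+1}}{a_0^2}-\frac{(n+2)a_{n+2}}{a_0}-\sum_{k=0}^{n-1}\frac{(-1)^k m_k a_{n-k}}{a_0}.$ Moreover, the zeros of $\Xi$ with positive real part have a smallest real part $s_1>0$, and the Riemann hypothesis (every zero of $\zeta$ other than the trivial zeros $-2,-4,-6,\dots$ has real part $\frac12$) holds if and only if there is a positive number $L>s_1^{-2}$ such that $$\sum_{j=0}^{k}(-1)^j\binom kj\frac{m_{n+j}}{L^{n+j}}\ge 0\qquad\text{for all } n,k\in\mathbb N_0,$$ that is, each of these sums is real and nonnegative. -/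

import Mathlib

open scoped ComplexOrder

namespace RiemannXi

/-- The Riemann `ξ`-function, the entire function given by
`ξ(s) = π^(-s/2) (s - 1) Γ(1 + s/2) ζ(s)`. It is written through the entire function
`Λ₀(s) = π^(-s/2) Γ(s/2) ζ(s) + 1/s + 1/(1-s)`, so that the removable singularities of that
formula (at `s = 1` and at `s = -2, -4, …`) carry the correct values; see `xi_eq` and
`differentiable_xi`. -/
noncomputable def xi (s : ℂ) : ℂ :=
  s * (s - 1) / 2 * completedRiemannZeta₀ s + 1 / 2

theorem differentiable_xi : Differentiable ℂ xi := by
  have h := differentiable_completedZeta₀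
  unfold xi
  fun_prop

/-- `xi` agrees with the product formula wherever the factors of the latter are finite. -/
theorem xi_eq {s : ℂ} (hs : s ≠ 1) (hs' : ∀ n : ℕ, s ≠ -2 * (n + 1)) :
    xi s = (Real.pi : ℂ) ^ (-s / 2) * (s - 1) * Complex.Gamma (1 + s / 2) * riemannZeta s := by
  have hG : Complex.Gamma (s / 2 + 1) ≠ 0 := by
    refine Complex.Gamma_ne_zero fun n hn => hs' n ?_
    linear_combination 2 * hn
  have hpi : (Real.pi : ℂ) ^ (-s / 2) ≠ 0 := by
    simp [Complex.cpow_eq_zero_iff, Real.pi_ne_zero]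
  have h1 : 1 - s ≠ 0 := sub_ne_zero.mpr hs.symm
  rw [riemannZeta_eq_mul_completedRiemannZeta₀, add_comm 1 (s / 2), xi]
  generalize Complex.Gamma (s / 2 + 1) = g at *
  field_simp
  ring

/-- The Riemann `Ξ`-function `Ξ(s) = ξ(1/2 + i s)`. -/
noncomputable def Xi (s : ℂ) : ℂ :=
  xi (1 / 2 + Complex.I * s)

/-- `Φ(u) = ∑_{n ≥ 1} (4 n⁴ π² e^{9u/2} - 6 n² π e^{5u/2}) e^{-n² π e^{2u}}`; the summation
index is shifted by one. -/
noncomputable def Phi (u : ℝ) : ℝ :=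
  ∑' n : ℕ, (4 * ((n : ℝ) + 1) ^ 4 * Real.pi ^ 2 * Real.exp (9 * u / 2)
      - 6 * ((n : ℝ) + 1) ^ 2 * Real.pi * Real.exp (5 * u / 2))
    * Real.exp (-((n : ℝ) + 1) ^ 2 * Real.pi * Real.exp (2 * u))

/-- `aₙ = (2 / (2n)!) ∫₀^∞ Φ(u) u^{2n} du`. -/
noncomputable def a (n : ℕ) : ℝ :=
  2 / ((2 * n).factorial : ℝ) * ∫ u in Set.Ioi (0 : ℝ), Phi u * u ^ (2 * n)

/-- `m_k = -(1 / (2 (2k+3)!)) (Ξ'/Ξ)^{(2k+3)}(0)`. -/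
noncomputable def m (k : ℕ) : ℂ :=
  -(1 / (((2 * k + 3).factorial : ℂ) * 2))
    * iteratedDeriv (2 * k + 3) (fun s : ℂ => deriv Xi s / Xi s) 0

/-- The `(n+1) × (n+1)` matrix of the determinant formula (rows and columns counted from `0`):
the columns before the last are those of the unit lower triangular Toeplitz matrix with entries
`a_{i-j}/a₀` below the diagonal, and the last column has the entries
`a₁ a_{i+1}/a₀² - (i+2) a_{i+2}/a₀`. -/
noncomputable def momentMatrix (n : ℕ) : Matrix (Fin (n + 1)) (Fin (n + 1)) ℝ :=
  Matrix.of fun i j =>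
    if j = Fin.last n then
      a 1 * a ((i : ℕ) + 1) / a 0 ^ 2 - (((i : ℕ) : ℝ) + 2) * a ((i : ℕ) + 2) / a 0
    else if j < i then a ((i : ℕ) - (j : ℕ)) / a 0
    else if j = i then 1
    else 0

/-- The set of positive real parts of zeros of `Ξ`. -/
def positiveZeroRealParts : Set ℝ :=
  {t : ℝ | 0 < t ∧ ∃ z : ℂ, Xi z = 0 ∧ z.re = t}

end RiemannXi

namespace RiemannXi

/-! With `thetaEven u = e^{u/2} θ(e^{2u})` one has `2Φ = thetaEven'' - thetaEven / 4`. Jacobi's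
functional equation makes `thetaEven` even, hence Φ too. Termwise Mellin transforms then give `ξ(1/2
+ τ) = 2 ∫₀^∞ Φ(u) cosh(τu) du` for real `τ > 1/2`. Expanding cosh and applying the identity theorem
yields the power series (`hasSum_xi`), and `Φ > 0` on `[0, ∞)` yields `aₙ > 0`.

Comparing Taylor coefficients in `Ξ' = (Ξ'/Ξ) Ξ` gives a unit lower triangular Toeplitz system for
the numbers `(-1)^k m_k` (`sum_m_mul_a`). Its last row is the recursion, and Cramer's rule gives the
determinant.

RH says that all zeros ρ of Ξ are real. Morally `m_k` is half the sum of `λ^(k+2)`, `λ = 1/ρ²`, over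
all zeros. In place of a Hadamard product, the zeros in a disc are divided out and the logarithmic
derivative of the quotient is bounded by Borel-Carathéodory; as Ξ has order 1, the error vanishes as
the disc grows (`exists_zeros_approx_m`). Under RH every λ lies in `(0, s₁⁻²]`, so the sums in
question are limits of sums of `(λ²/2) (λ/L)^n (1 - λ/L)^k ≥ 0`.

Conversely, the inequalities say that `m_n / L^n` is completely monotone. As in Hausdorff's moment
problem, Bernstein polynomials produce a bounded functional `T` on `C[0,1]` with these moments, and
`T(1/(1 - wx))` continues the generating function off `[1, ∞)`. Hence `Ξ' = H Ξ` with `H` analytic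
wherever `L s² ∉ [1, ∞)`, in particular off the real axis, and this equation forbids zeros of Ξ
there. -/

/-! ### Theta series and the evenness and positivity of Φ. -/

/-- The sums `∑_{n ≥ 1} n^{2k} e^{-n² π t}`, which up to the factors `(-π)^k` are the derivatives
of half the theta function. -/
noncomputable def thetaMoment (k : ℕ) (t : ℝ) : ℝ :=
  ∑' n : ℕ, ((n : ℝ) + 1) ^ (2 * k) * Real.exp (-((n : ℝ) + 1) ^ 2 * Real.pi * t)

theorem summable_thetaMoment (k : ℕ) {t : ℝ} (ht : 0 < t) :
    Summable fun n : ℕ =>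
      ((n : ℝ) + 1) ^ (2 * k) * Real.exp (-((n : ℝ) + 1) ^ 2 * Real.pi * t) := by
  have h : Summable fun n : ℕ => (n : ℝ) ^ (2 * k) * Real.exp (-(Real.pi * t) * n) :=
    Real.summable_pow_mul_exp_neg_nat_mul _ (by positivity)
  have h' := (summable_nat_add_iff 1).mpr h
  refine Summable.of_nonneg_of_le (fun n => by positivity) (fun n => ?_) h'
  push_cast
  refine mul_le_mul_of_nonneg_left (Real.exp_le_exp.mpr ?_) (by positivity)
  have h1 : (0 : ℝ) ≤ n := n.cast_nonneg
  have h2 : 0 < Real.pi * t := by positivity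
  nlinarith [mul_nonneg h2.le (mul_nonneg h1 (by linarith : (0 : ℝ) ≤ n + 1))]

/-- Termwise differentiation on `y > t/2`, where each derivative is dominated by its value at `t/2`.
-/
theorem hasDerivAt_thetaMoment (k : ℕ) {t : ℝ} (ht : 0 < t) :
    HasDerivAt (thetaMoment k) (-Real.pi * thetaMoment (k + 1) t) t := by
  have key := hasDerivAt_tsum_of_isPreconnected (𝕜 := ℝ)
    (g := fun (n : ℕ) (y : ℝ) =>
      ((n : ℝ) + 1) ^ (2 * k) * Real.exp (-((n : ℝ) + 1) ^ 2 * Real.pi * y))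
    (g' := fun (n : ℕ) (y : ℝ) => -Real.pi *
      (((n : ℝ) + 1) ^ (2 * (k + 1)) * Real.exp (-((n : ℝ) + 1) ^ 2 * Real.pi * y)))
    (t := Set.Ioi (t / 2)) (y₀ := t) (y := t)
    ((summable_thetaMoment (k + 1) (half_pos ht)).mul_left Real.pi)
    isOpen_Ioi isPreconnected_Ioi ?_ ?_ (half_lt_self ht) (summable_thetaMoment k ht)
    (half_lt_self ht)
  · rw [tsum_mul_left] at key
    exact key
  · intro n y _
    have h := (((hasDerivAt_id y).const_mul (-((n : ℝ) + 1) ^ 2 * Real.pi)).exp).const_mul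
      (((n : ℝ) + 1) ^ (2 * k))
    convert! h using 1
    simp only [id]
    ring
  · intro n y hy
    rw [norm_mul, norm_neg, Real.norm_of_nonneg Real.pi_pos.le,
      Real.norm_of_nonneg (by positivity)]
    have hy' : t / 2 ≤ y := le_of_lt hy
    have : -((n : ℝ) + 1) ^ 2 * Real.pi * y ≤ -((n : ℝ) + 1) ^ 2 * Real.pi * (t / 2) := by
      have h2 : 0 < ((n : ℝ) + 1) ^ 2 * Real.pi := by positivity
      nlinarith
    gcongr

theorem Phi_eq (u : ℝ) :
    Phi u = 4 * Real.pi ^ 2 * Real.exp (9 * u / 2) * thetaMoment 2 (Real.exp (2 * u))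
      - 6 * Real.pi * Real.exp (5 * u / 2) * thetaMoment 1 (Real.exp (2 * u)) := by
  unfold Phi thetaMoment
  rw [← tsum_mul_left, ← tsum_mul_left, ← Summable.tsum_sub]
  · exact tsum_congr fun n => by ring
  · exact (summable_thetaMoment 2 (Real.exp_pos _)).mul_left _
  · exact (summable_thetaMoment 1 (Real.exp_pos _)).mul_left _

theorem thetaMoment_zero_functional_equation {t : ℝ} (ht : 0 < t) :
    1 + 2 * thetaMoment 0 t = 1 / t ^ (1 / 2 : ℝ) * (1 + 2 * thetaMoment 0 t⁻¹) := by
  have key : ∀ {t : ℝ}, 0 < t →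
      ∑' n : ℤ, Real.exp (-Real.pi * t * (n : ℝ) ^ 2) = 1 + 2 * thetaMoment 0 t := by
    intro t ht
    have hs : HasSum (fun n : ℕ => Real.exp (-Real.pi * t * ((n : ℝ) + 1) ^ 2))
        (thetaMoment 0 t) := by
      have := (summable_thetaMoment 0 ht).hasSum
      convert! this using 2 with n
      rw [Nat.mul_zero, pow_zero, one_mul]
      congr 1
      ring
    have h := HasSum.of_nat_of_neg_add_one (f := fun n : ℤ => Real.exp (-Real.pi * t * (n : ℝ) ^ 2))
      (m := 1 + thetaMoment 0 t) (m' := thetaMoment 0 t) ?_ ?_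
    · rw [h.tsum_eq]; ring
    · rw [← hasSum_nat_add_iff' 1]
      simpa using hs
    · convert! hs using 2 with n
      push_cast
      ring_nf
  rw [← key ht, Real.tsum_exp_neg_mul_int_sq ht, ← key (inv_pos.mpr ht)]
  simp only [div_eq_mul_inv]

/-- The function `e^{u/2} θ(e^{2u})`. -/
noncomputable def thetaEven (u : ℝ) : ℝ :=
  Real.exp (u / 2) * (1 + 2 * thetaMoment 0 (Real.exp (2 * u)))

theorem thetaEven_neg (u : ℝ) : thetaEven (-u) = thetaEven u := by
  unfold thetaEven
  rw [thetaMoment_zero_functional_equation (Real.exp_pos (2 * u)), ← Real.exp_neg,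
    ← Real.exp_mul, one_div, ← Real.exp_neg, ← mul_assoc, ← Real.exp_add]
  ring_nf

theorem hasDerivAt_thetaMoment_exp (k : ℕ) (u : ℝ) :
    HasDerivAt (fun u => thetaMoment k (Real.exp (2 * u)))
      (-2 * Real.pi * Real.exp (2 * u) * thetaMoment (k + 1) (Real.exp (2 * u))) u := by
  have h1 : HasDerivAt (fun u : ℝ => Real.exp (2 * u)) (Real.exp (2 * u) * (2 * 1)) u :=
    ((hasDerivAt_id u).const_mul 2).exp
  have h := (hasDerivAt_thetaMoment k (Real.exp_pos (2 * u))).comp u h1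
  convert! h using 1
  ring

theorem hasDerivAt_exp_mul (c u : ℝ) :
    HasDerivAt (fun u : ℝ => Real.exp (c * u)) (c * Real.exp (c * u)) u := by
  have h := ((hasDerivAt_id u).const_mul c).exp
  simpa [mul_comm] using h

theorem hasDerivAt_thetaEven (u : ℝ) : HasDerivAt thetaEven
    (Real.exp (u / 2) * (1 + 2 * thetaMoment 0 (Real.exp (2 * u))) / 2
      - 4 * Real.pi * (Real.exp (5 / 2 * u) * thetaMoment 1 (Real.exp (2 * u)))) u := by
  have h1 := hasDerivAt_exp_mul (1 / 2) u
  have h2 := h1.mul (((hasDerivAt_thetaMoment_exp 0 u).const_mul 2).const_add 1)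
  have h3 : (fun u : ℝ => Real.exp (1 / 2 * u)) *
      (fun u => 1 + 2 * thetaMoment 0 (Real.exp (2 * u))) = thetaEven := by
    ext u
    simp only [thetaEven, Pi.mul_apply]
    ring_nf
  rw [h3] at h2
  convert! h2 using 1
  rw [show 5 / 2 * u = 1 / 2 * u + 2 * u by ring, Real.exp_add]
  ring_nf

theorem deriv_thetaEven : deriv thetaEven = fun u =>
    Real.exp (u / 2) * (1 + 2 * thetaMoment 0 (Real.exp (2 * u))) / 2
      - 4 * Real.pi * (Real.exp (5 / 2 * u) * thetaMoment 1 (Real.exp (2 * u))) :=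
  funext fun u => (hasDerivAt_thetaEven u).deriv

theorem deriv_deriv_thetaEven (u : ℝ) :
    deriv (deriv thetaEven) u = thetaEven u / 4 + 2 * Phi u := by
  have hd : DifferentiableAt ℝ thetaEven u := (hasDerivAt_thetaEven u).differentiableAt
  have h4 := (hd.hasDerivAt.div_const 2).sub
    (((hasDerivAt_exp_mul (5 / 2) u).mul (hasDerivAt_thetaMoment_exp 1 u)).const_mul
      (4 * Real.pi))
  have h5 : deriv thetaEven = (fun u => thetaEven u / 2) - fun u => 4 * Real.pi *
      ((fun u : ℝ => Real.exp (5 / 2 * u)) * (fun u => thetaMoment 1 (Real.exp (2 * u)))) u := by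
    rw [deriv_thetaEven]
    rfl
  rw [h5, h4.deriv, deriv_thetaEven, Phi_eq, thetaEven,
    show 9 * u / 2 = 5 / 2 * u + 2 * u by ring, Real.exp_add,
    show 5 * u / 2 = 5 / 2 * u by ring]
  ring

/-- Φ is a combination of `thetaEven` and its second derivative, so it inherits the evenness that
Jacobi's functional equation gives `thetaEven`. -/
theorem Phi_neg (u : ℝ) : Phi (-u) = Phi u := by
  have h0 : (fun u => thetaEven (-u)) = thetaEven := funext thetaEven_neg
  have h1 : ∀ u, deriv thetaEven (-u) = -deriv thetaEven u := by
    intro u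
    have := deriv_comp_neg thetaEven u
    rw [h0] at this
    rw [this, neg_neg]
  have h2 : deriv (deriv thetaEven) (-u) = deriv (deriv thetaEven) u := by
    have := deriv_comp_neg (deriv thetaEven) u
    rw [show (fun x => deriv thetaEven (-x)) = fun x => -deriv thetaEven x from funext h1,
      deriv.fun_neg] at this
    linarith
  rw [deriv_deriv_thetaEven, deriv_deriv_thetaEven, thetaEven_neg] at h2
  linarith

theorem continuous_Phi : Continuous Phi := by
  have h : ∀ k, Continuous fun u => thetaMoment k (Real.exp (2 * u)) := fun k =>
    continuous_iff_continuousAt.mpr fun u => (hasDerivAt_thetaMoment_exp k u).continuousAt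
  rw [funext Phi_eq]
  have h1 := h 1
  have h2 := h 2
  fun_prop

theorem Phi_pos {u : ℝ} (hu : 0 ≤ u) : 0 < Phi u := by
  have hs : Summable fun n : ℕ => (4 * ((n : ℝ) + 1) ^ 4 * Real.pi ^ 2 * Real.exp (9 * u / 2)
      - 6 * ((n : ℝ) + 1) ^ 2 * Real.pi * Real.exp (5 * u / 2))
    * Real.exp (-((n : ℝ) + 1) ^ 2 * Real.pi * Real.exp (2 * u)) := by
    convert! ((summable_thetaMoment 2 (Real.exp_pos (2 * u))).mul_left
      (4 * Real.pi ^ 2 * Real.exp (9 * u / 2))).sub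
      ((summable_thetaMoment 1 (Real.exp_pos (2 * u))).mul_left
      (6 * Real.pi * Real.exp (5 * u / 2))) using 2 with n
    ring
  have hpos : ∀ n : ℕ, 0 < (4 * ((n : ℝ) + 1) ^ 4 * Real.pi ^ 2 * Real.exp (9 * u / 2)
      - 6 * ((n : ℝ) + 1) ^ 2 * Real.pi * Real.exp (5 * u / 2))
    * Real.exp (-((n : ℝ) + 1) ^ 2 * Real.pi * Real.exp (2 * u)) := by
    intro n
    refine mul_pos ?_ (Real.exp_pos _)
    have h1 : Real.exp (9 * u / 2) = Real.exp (5 * u / 2) * Real.exp (2 * u) := by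
      rw [← Real.exp_add]; ring_nf
    have h2 : 1 ≤ Real.exp (2 * u) := Real.one_le_exp (by positivity)
    have h3 : (1 : ℝ) ≤ ((n : ℝ) + 1) ^ 2 := one_le_pow₀ (by simp)
    have h4 : 3 < Real.pi := Real.pi_gt_three
    -- Each summand is `2n²π e^{5u/2} (2n²π e^{2u} - 3)` times an exponential, so `π > 3` is more
    -- than enough.
    have h5 : 3 < ((n : ℝ) + 1) ^ 2 * Real.pi * Real.exp (2 * u) := by
      have : 1 ≤ ((n : ℝ) + 1) ^ 2 * Real.exp (2 * u) := one_le_mul_of_one_le_of_one_le h3 h2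
      nlinarith
    have h6 : 0 < 2 * ((n : ℝ) + 1) ^ 2 * Real.pi * Real.exp (5 * u / 2) := by positivity
    rw [h1]
    nlinarith
  exact hs.tsum_pos (fun n => (hpos n).le) 0 (hpos 0)

/-! ### Mellin transforms and the integral representation of ξ. -/

open MeasureTheory

theorem summable_one_div_nat_add_one_rpow {σ : ℝ} (hσ : 1 < σ) :
    Summable fun n : ℕ => 1 / ((n : ℝ) + 1) ^ σ := by
  have h := (summable_nat_add_iff 1).mpr (Real.summable_one_div_nat_rpow.mpr hσ)
  simpa using h

theorem tsum_one_div_nat_add_one_rpow_pos {σ : ℝ} (hσ : 1 < σ) :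
    0 < ∑' n : ℕ, 1 / ((n : ℝ) + 1) ^ σ :=
  (summable_one_div_nat_add_one_rpow hσ).tsum_pos (fun n => by positivity) 0 (by positivity)

theorem integral_rpow_mul_thetaMoment (k : ℕ) {σ : ℝ} (hσ : 1 < σ) :
    ∫ t in Set.Ioi (0 : ℝ), t ^ (σ / 2 + k - 1) * thetaMoment k t =
      Real.Gamma (σ / 2 + k) * Real.pi ^ (-(σ / 2 + k)) * ∑' n : ℕ, 1 / ((n : ℝ) + 1) ^ σ := by
  have hr : 0 < σ / 2 + k := by positivity
  have hval : ∀ n : ℕ, ∫ t in Set.Ioi (0 : ℝ), t ^ (σ / 2 + k - 1) *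
      (((n : ℝ) + 1) ^ (2 * k) * Real.exp (-((n : ℝ) + 1) ^ 2 * Real.pi * t)) =
      Real.Gamma (σ / 2 + k) * Real.pi ^ (-(σ / 2 + k)) * (1 / ((n : ℝ) + 1) ^ σ) := by
    intro n
    have hn : (0 : ℝ) < n + 1 := by positivity
    have h := Real.integral_rpow_mul_exp_neg_mul_Ioi hr
      (show 0 < ((n : ℝ) + 1) ^ 2 * Real.pi by positivity)
    have h2 : ∀ t : ℝ, t ^ (σ / 2 + k - 1) *
        (((n : ℝ) + 1) ^ (2 * k) * Real.exp (-((n : ℝ) + 1) ^ 2 * Real.pi * t)) =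
        ((n : ℝ) + 1) ^ (2 * k) *
        (t ^ (σ / 2 + k - 1) * Real.exp (-(((n : ℝ) + 1) ^ 2 * Real.pi * t))) := by
      intro t; ring_nf
    simp_rw [h2, integral_const_mul, h]
    rw [one_div, Real.inv_rpow (by positivity), Real.mul_rpow (by positivity) Real.pi_pos.le,
      Real.rpow_neg Real.pi_pos.le, ← Real.rpow_natCast_mul hn.le,
      show ((2 : ℕ) : ℝ) * (σ / 2 + k) = σ + (2 * k : ℕ) by push_cast; ring,
      Real.rpow_add hn, Real.rpow_natCast]
    field_simp
  have hint : ∀ n : ℕ, Integrable (fun t => t ^ (σ / 2 + k - 1) *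
      (((n : ℝ) + 1) ^ (2 * k) * Real.exp (-((n : ℝ) + 1) ^ 2 * Real.pi * t)))
      (volume.restrict (Set.Ioi (0 : ℝ))) := by
    intro n
    -- A non-integrable function has integral 0 by convention, so a nonzero value of the integral
    -- proves integrability.
    refine Integrable.of_integral_ne_zero ?_
    rw [hval n]
    have := Real.Gamma_pos_of_pos hr
    positivity
  have h := hasSum_integral_of_summable_integral_norm hint ?_
  · simp_rw [hval, tsum_mul_left] at h
    have h' := ((summable_one_div_nat_add_one_rpow hσ).hasSum.mul_left
      (Real.Gamma (σ / 2 + k) * Real.pi ^ (-(σ / 2 + k)))).unique h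
    exact h'.symm
  · have : ∀ n : ℕ, ∫ t in Set.Ioi (0 : ℝ), ‖t ^ (σ / 2 + k - 1) *
      (((n : ℝ) + 1) ^ (2 * k) * Real.exp (-((n : ℝ) + 1) ^ 2 * Real.pi * t))‖ =
      Real.Gamma (σ / 2 + k) * Real.pi ^ (-(σ / 2 + k)) * (1 / ((n : ℝ) + 1) ^ σ) := by
      intro n
      rw [← hval n]
      refine setIntegral_congr_fun measurableSet_Ioi fun t ht => ?_
      have ht' : (0 : ℝ) < t := ht
      exact Real.norm_of_nonneg (by positivity)
    simp_rw [this]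
    exact (summable_one_div_nat_add_one_rpow hσ).mul_left _

theorem integral_exp_mul_thetaMoment (k : ℕ) {σ : ℝ} (hσ : 1 < σ) :
    ∫ u : ℝ, Real.exp ((σ + 2 * k) * u) * thetaMoment k (Real.exp (2 * u)) =
      Real.Gamma (σ / 2 + k) * Real.pi ^ (-(σ / 2 + k)) *
        (∑' n : ℕ, 1 / ((n : ℝ) + 1) ^ σ) / 2 := by
  have himage : (fun u : ℝ => Real.exp (2 * u)) '' Set.univ = Set.Ioi 0 := by
    ext t
    simp only [Set.image_univ, Set.mem_range, Set.mem_Ioi]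
    refine ⟨fun ⟨u, hu⟩ => hu ▸ Real.exp_pos _, fun ht => ⟨Real.log t / 2, ?_⟩⟩
    rw [mul_div_cancel₀ _ two_ne_zero, Real.exp_log ht]
  have h := integral_image_eq_integral_abs_deriv_smul MeasurableSet.univ
    (fun u _ => (hasDerivAt_exp_mul 2 u).hasDerivWithinAt)
    (fun u _ v _ huv => by simpa using huv)
    (fun t => t ^ (σ / 2 + k - 1) * thetaMoment k t)
  rw [himage, integral_rpow_mul_thetaMoment k hσ, Measure.restrict_univ] at h
  rw [h, eq_div_iff two_ne_zero, mul_comm, ← integral_const_mul]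
  refine integral_congr_ae (Filter.Eventually.of_forall fun u => ?_)
  simp only [smul_eq_mul]
  rw [abs_of_pos (by positivity), ← Real.exp_mul,
    show (σ + 2 * k) * u = 2 * u + 2 * u * (σ / 2 + k - 1) by ring, Real.exp_add]
  ring

theorem integrable_exp_mul_thetaMoment (k : ℕ) {σ : ℝ} (hσ : 1 < σ) :
    Integrable fun u : ℝ => Real.exp ((σ + 2 * k) * u) * thetaMoment k (Real.exp (2 * u)) := by
  refine Integrable.of_integral_ne_zero ?_
  rw [integral_exp_mul_thetaMoment k hσ]
  have := Real.Gamma_pos_of_pos (show 0 < σ / 2 + k by positivity)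
  have := tsum_one_div_nat_add_one_rpow_pos hσ
  positivity

theorem Phi_mul_exp_eq (σ u : ℝ) : Phi u * Real.exp ((σ - 1 / 2) * u) =
    4 * Real.pi ^ 2 * (Real.exp ((σ + 2 * (2 : ℕ)) * u) * thetaMoment 2 (Real.exp (2 * u)))
      - 6 * Real.pi *
        (Real.exp ((σ + 2 * (1 : ℕ)) * u) * thetaMoment 1 (Real.exp (2 * u))) := by
  rw [Phi_eq, show (σ + 2 * (2 : ℕ)) * u = 9 * u / 2 + (σ - 1 / 2) * u by push_cast; ring,
    show (σ + 2 * (1 : ℕ)) * u = 5 * u / 2 + (σ - 1 / 2) * u by push_cast; ring, Real.exp_add,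
    Real.exp_add]
  ring

theorem integrable_Phi_mul_exp {σ : ℝ} (hσ : 1 < σ) :
    Integrable fun u : ℝ => Phi u * Real.exp ((σ - 1 / 2) * u) := by
  simp_rw [Phi_mul_exp_eq]
  exact ((integrable_exp_mul_thetaMoment 2 hσ).const_mul _).sub
    ((integrable_exp_mul_thetaMoment 1 hσ).const_mul _)

theorem xi_ofReal {σ : ℝ} (hσ : 1 < σ) :
    xi σ = ((Real.pi ^ (-σ / 2) * (σ - 1) * Real.Gamma (1 + σ / 2) *
      ∑' n : ℕ, 1 / ((n : ℝ) + 1) ^ σ : ℝ) : ℂ) := by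
  rw [xi_eq (by exact_mod_cast hσ.ne')
    (fun n hn => by
      have h1 := congrArg Complex.re hn
      simp at h1
      have : (0 : ℝ) ≤ n := n.cast_nonneg
      linarith), zeta_eq_tsum_one_div_nat_add_one_cpow (by simpa using hσ)]
  push_cast
  rw [Complex.ofReal_cpow Real.pi_pos.le, ← Complex.Gamma_ofReal]
  push_cast
  congr 1
  refine tsum_congr fun n => ?_
  rw [Complex.ofReal_cpow (by positivity)]
  push_cast
  rfl

/-- By `Γ(σ/2 + 2) = (σ/2 + 1) Γ(σ/2 + 1)` the two Mellin transforms combine with the factor `2(σ/2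
+ 1) - 3 = σ - 1`. -/
theorem xi_eq_integral {σ : ℝ} (hσ : 1 < σ) :
    xi σ = ((∫ u : ℝ, Phi u * Real.exp ((σ - 1 / 2) * u) : ℝ) : ℂ) := by
  rw [xi_ofReal hσ]
  congr 1
  simp_rw [Phi_mul_exp_eq]
  rw [integral_sub ((integrable_exp_mul_thetaMoment 2 hσ).const_mul _)
    ((integrable_exp_mul_thetaMoment 1 hσ).const_mul _), integral_const_mul, integral_const_mul,
    integral_exp_mul_thetaMoment 2 hσ, integral_exp_mul_thetaMoment 1 hσ]
  have hσ0 : σ / 2 + 1 ≠ 0 := by positivity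
  have hpi := Real.pi_pos
  push_cast
  rw [show σ / 2 + 2 = σ / 2 + 1 + 1 by ring, Real.Gamma_add_one hσ0,
    show -(σ / 2 + 1 + 1) = -σ / 2 - 2 by ring, show -(σ / 2 + 1) = -σ / 2 - 1 by ring,
    Real.rpow_sub hpi, Real.rpow_sub hpi, Real.rpow_one, Real.rpow_two, add_comm 1 (σ / 2)]
  field_simp
  ring

theorem integrable_Phi_mul_cosh (r : ℝ) :
    Integrable fun u : ℝ => Phi u * Real.cosh (r * u) := by
  -- The exponent `|r| + 1` dominates `|r|` and equals `σ - 1/2` for an admissible `σ = |r| + 3/2 >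
  -- 1`.
  have h1 : Integrable fun u : ℝ => Phi u * Real.exp ((|r| + 1) * u) := by
    have h := integrable_Phi_mul_exp (show 1 < |r| + 3 / 2 by linarith [abs_nonneg r])
    convert! h using 4
    ring
  have h2 : Integrable fun u : ℝ => Phi u * Real.exp (-((|r| + 1) * u)) := by
    have h := h1.comp_neg
    simpa only [Phi_neg, mul_neg] using h
  have h3 : Integrable fun u : ℝ => Phi u * Real.cosh ((|r| + 1) * u) := by
    convert! (h1.add h2).div_const 2 using 2 with u
    simp only [Pi.add_apply, Real.cosh_eq]
    ring
  refine h3.mono ?_ (Filter.Eventually.of_forall fun u => ?_)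
  · have := continuous_Phi
    exact Continuous.aestronglyMeasurable (by fun_prop)
  · rw [norm_mul, norm_mul]
    refine mul_le_mul_of_nonneg_left ?_ (norm_nonneg _)
    rw [Real.norm_of_nonneg (Real.cosh_pos _).le, Real.norm_of_nonneg (Real.cosh_pos _).le,
      Real.cosh_le_cosh, abs_mul, abs_mul, abs_of_nonneg (show 0 ≤ |r| + 1 by positivity)]
    gcongr
    linarith

theorem xi_eq_integral_cosh {τ : ℝ} (hτ : 1 / 2 < τ) :
    xi (1 / 2 + τ) = ((∫ u in Set.Ioi (0 : ℝ), 2 * (Phi u * Real.cosh (τ * u)) : ℝ) : ℂ) := by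
  have h := xi_eq_integral (show 1 < 1 / 2 + τ by linarith)
  have hi := integrable_Phi_mul_exp (show 1 < 1 / 2 + τ by linarith)
  push_cast at h
  rw [h]
  congr 1
  simp only [add_sub_cancel_left] at hi ⊢
  have hneg : ∫ u : ℝ, Phi u * Real.exp (τ * -u) = ∫ u : ℝ, Phi u * Real.exp (τ * u) := by
    have := integral_neg_eq_self (fun u => Phi u * Real.exp (τ * u)) volume
    simpa only [Phi_neg] using this
  have hi' : Integrable fun u : ℝ => Phi u * Real.exp (τ * -u) := by
    simpa only [Phi_neg] using hi.comp_neg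
  rw [integral_const_mul, ← integral_comp_abs (f := fun u => Phi u * Real.cosh (τ * u))]
  have habs : ∀ u : ℝ, Phi |u| * Real.cosh (τ * |u|) =
      (Phi u * Real.exp (τ * u) + Phi u * Real.exp (τ * -u)) / 2 := by
    intro u
    have h1 : Phi |u| = Phi u := by rcases abs_choice u with h | h <;> simp [h, Phi_neg]
    have h2 : Real.cosh (τ * |u|) = Real.cosh (τ * u) := by
      rcases abs_choice u with h | h <;> simp [h]
    rw [h1, h2, Real.cosh_eq]
    ring_nf
  simp_rw [habs]
  rw [integral_div, integral_add hi hi', hneg]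
  ring

/-! ### The power series of ξ about 1/2. -/

theorem integrableOn_Phi_mul_pow (n : ℕ) :
    IntegrableOn (fun u => Phi u * u ^ (2 * n)) (Set.Ioi 0) := by
  have h := ((integrable_Phi_mul_cosh 1).const_mul ((2 * n).factorial : ℝ)).integrableOn
    (s := Set.Ioi (0 : ℝ))
  refine h.mono' ?_ ?_
  · have := continuous_Phi
    exact Continuous.aestronglyMeasurable (by fun_prop)
  · refine (ae_restrict_iff' measurableSet_Ioi).mpr (Filter.Eventually.of_forall fun u hu => ?_)
    have hu' : (0 : ℝ) < u := hu
    have hP := Phi_pos hu'.le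
    rw [Real.norm_of_nonneg (by positivity), one_mul, mul_left_comm]
    refine mul_le_mul_of_nonneg_left ?_ hP.le
    have h2 := (Real.hasSum_cosh u).summable.le_tsum n (fun m _ => by positivity)
    rw [(Real.hasSum_cosh u).tsum_eq, div_le_iff₀ (by positivity)] at h2
    linarith

theorem a_pos (n : ℕ) : 0 < a n := by
  unfold a
  refine mul_pos (by positivity) ?_
  rw [setIntegral_pos_iff_support_of_nonneg_ae _ (integrableOn_Phi_mul_pow n)]
  · have : Function.support (fun u => Phi u * u ^ (2 * n)) ∩ Set.Ioi 0 = Set.Ioi 0 := by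
      refine Set.inter_eq_right.mpr fun u hu => ?_
      have hu' : (0 : ℝ) < u := hu
      have hP := Phi_pos hu'.le
      exact (by positivity : 0 < Phi u * u ^ (2 * n)).ne'
    rw [this]
    simp
  · refine (ae_restrict_iff' measurableSet_Ioi).mpr (Filter.Eventually.of_forall fun u hu => ?_)
    have hu' : (0 : ℝ) < u := hu
    have hP := Phi_pos hu'.le
    exact (by positivity : 0 ≤ Phi u * u ^ (2 * n))

theorem hasSum_a_mul_pow (s : ℂ) :
    HasSum (fun n : ℕ => (a n : ℂ) * s ^ (2 * n))
      (∫ u in Set.Ioi (0 : ℝ), 2 * ((Phi u : ℂ) * Complex.cosh (s * u))) := by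
  have hterm : ∀ u : ℝ, HasSum (fun n : ℕ =>
      2 * ((Phi u : ℂ) * ((s * u) ^ (2 * n) / ((2 * n).factorial : ℂ))))
      (2 * ((Phi u : ℂ) * Complex.cosh (s * u))) := fun u =>
    ((Complex.hasSum_cosh (s * u)).mul_left _).mul_left _
  have hb : ∀ u : ℝ, HasSum (fun n : ℕ =>
      2 * (Phi u * ((‖s‖ * u) ^ (2 * n) / ((2 * n).factorial : ℝ))))
      (2 * (Phi u * Real.cosh (‖s‖ * u))) := fun u =>
    ((Real.hasSum_cosh (‖s‖ * u)).mul_left _).mul_left _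
  have h := hasSum_integral_of_dominated_convergence
    (μ := volume.restrict (Set.Ioi (0 : ℝ)))
    (F := fun (n : ℕ) (u : ℝ) => 2 * ((Phi u : ℂ) * ((s * u) ^ (2 * n) / ((2 * n).factorial : ℂ))))
    (f := fun u : ℝ => 2 * ((Phi u : ℂ) * Complex.cosh (s * u)))
    (fun (n : ℕ) (u : ℝ) => 2 * (Phi u * ((‖s‖ * u) ^ (2 * n) / ((2 * n).factorial : ℝ))))
    ?_ ?_ ?_ ?_ ?_
  · convert! h using 2 with n
    have h2 : ∀ u : ℝ, 2 * ((Phi u : ℂ) * ((s * u) ^ (2 * n) / ((2 * n).factorial : ℂ))) =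
        (2 / ((2 * n).factorial : ℂ) * s ^ (2 * n)) * ((Phi u * u ^ (2 * n) : ℝ) : ℂ) := by
      intro u
      push_cast
      ring
    simp_rw [h2, integral_const_mul, integral_complex_ofReal, a]
    push_cast
    ring
  · intro n
    have := continuous_Phi
    exact Continuous.aestronglyMeasurable (by fun_prop)
  · intro n
    refine (ae_restrict_iff' measurableSet_Ioi).mpr (Filter.Eventually.of_forall fun u hu => ?_)
    have hu' : (0 : ℝ) < u := hu
    have hP := Phi_pos hu'.le
    simp only [norm_mul, norm_div, norm_pow, Complex.norm_real, Complex.norm_natCast,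
      Real.norm_of_nonneg hu'.le, Real.norm_of_nonneg hP.le, Complex.norm_ofNat, le_refl]
  · exact Filter.Eventually.of_forall fun u => (hb u).summable
  · simp_rw [fun u => (hb u).tsum_eq]
    exact ((integrable_Phi_mul_cosh ‖s‖).const_mul 2).integrableOn
  · exact Filter.Eventually.of_forall hterm

theorem differentiable_tsum_a_mul_pow :
    Differentiable ℂ fun s : ℂ => ∑' n : ℕ, (a n : ℂ) * s ^ (2 * n) := by
  intro s
  have h := Complex.differentiableOn_tsum_of_summable_norm
    (F := fun (n : ℕ) (s : ℂ) => (a n : ℂ) * s ^ (2 * n)) (U := Metric.ball 0 (‖s‖ + 1))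
    (hasSum_a_mul_pow ((‖s‖ + 1 : ℝ) : ℂ)).summable.norm (fun n => by fun_prop)
    Metric.isOpen_ball ?_
  · exact h.differentiableAt (Metric.isOpen_ball.mem_nhds (by simp))
  · intro n w hw
    rw [mem_ball_zero_iff] at hw
    simp only [norm_mul, norm_pow, Complex.norm_real]
    rw [Real.norm_of_nonneg (show 0 ≤ ‖s‖ + 1 by positivity)]
    gcongr

theorem hasSum_xi (s : ℂ) :
    HasSum (fun n : ℕ => (a n : ℂ) * s ^ (2 * n)) (xi (1 / 2 + s)) := by
  have hd : Differentiable ℂ fun s : ℂ => xi (1 / 2 + s) := by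
    have := differentiable_xi
    fun_prop
  have heq : (fun s : ℂ => ∑' n : ℕ, (a n : ℂ) * s ^ (2 * n)) = fun s : ℂ => xi (1 / 2 + s) := by
    refine AnalyticOnNhd.eq_of_frequently_eq (𝕜 := ℂ) (z₀ := ((1 : ℝ) : ℂ))
      (differentiable_tsum_a_mul_pow.differentiableOn.analyticOnNhd isOpen_univ)
      (hd.differentiableOn.analyticOnNhd isOpen_univ) ?_
    -- Both sides are entire and agree at real `τ > 1/2`; these points accumulate at 1.
    have ht : Filter.Tendsto ((↑) : ℝ → ℂ) (nhdsWithin 1 {1}ᶜ)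
        (nhdsWithin ((1 : ℝ) : ℂ) {((1 : ℝ) : ℂ)}ᶜ) := by
      refine tendsto_nhdsWithin_iff.mpr
        ⟨(Complex.continuous_ofReal.tendsto 1).mono_left nhdsWithin_le_nhds, ?_⟩
      filter_upwards [self_mem_nhdsWithin] with x hx
      simpa using hx
    refine ht.frequently (Filter.Eventually.frequently ?_)
    filter_upwards [nhdsWithin_le_nhds (lt_mem_nhds (show (1 / 2 : ℝ) < 1 by norm_num))] with τ hτ
    rw [xi_eq_integral_cosh hτ, (hasSum_a_mul_pow τ).tsum_eq, ← integral_complex_ofReal]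
    push_cast
    rfl
  have := congrFun heq s
  rw [← this]
  exact (hasSum_a_mul_pow s).summable.hasSum

theorem differentiable_Xi : Differentiable ℂ Xi := by
  have := differentiable_xi
  unfold Xi
  fun_prop

theorem hasSum_Xi (s : ℂ) :
    HasSum (fun n : ℕ => (-1) ^ n * (a n : ℂ) * s ^ (2 * n)) (Xi s) := by
  have h := hasSum_xi (Complex.I * s)
  have h2 : ∀ n : ℕ, (-1) ^ n * (a n : ℂ) * s ^ (2 * n) = a n * (Complex.I * s) ^ (2 * n) := by
    intro n
    rw [mul_pow, pow_mul Complex.I, Complex.I_sq]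
    ring
  simp_rw [h2]
  exact h

theorem Xi_zero : Xi 0 = a 0 := by
  have h := (hasSum_Xi 0).unique (hasSum_single 0 fun n hn => by simp [hn])
  simpa using h

theorem Xi_zero_ne : Xi 0 ≠ 0 := by
  rw [Xi_zero]
  exact_mod_cast (a_pos 0).ne'

theorem Xi_neg (s : ℂ) : Xi (-s) = Xi s := by
  refine (hasSum_Xi (-s)).unique ?_
  convert! hasSum_Xi s using 3 with n
  rw [pow_mul, neg_sq, ← pow_mul]

/-! ### Taylor coefficients of Ξ'/Ξ, the recursion and the determinant. -/

/-- The logarithmic derivative `Ξ' / Ξ`. -/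
noncomputable def logDerivXi (s : ℂ) : ℂ := deriv Xi s / Xi s

theorem eventually_Xi_ne_zero : ∀ᶠ s in nhds (0 : ℂ), Xi s ≠ 0 :=
  differentiable_Xi.continuous.continuousAt.eventually_ne Xi_zero_ne

theorem analyticAt_logDerivXi : AnalyticAt ℂ logDerivXi 0 := by
  have h : AnalyticAt ℂ Xi 0 := differentiable_Xi.analyticAt 0
  exact h.deriv.div h Xi_zero_ne

/-- The `n`-th Taylor coefficient at the origin. -/
noncomputable def taylorCoeff (f : ℂ → ℂ) (n : ℕ) : ℂ := iteratedDeriv n f 0 / n.factorial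

theorem taylorCoeff_congr {f g : ℂ → ℂ} (h : f =ᶠ[nhds 0] g) (n : ℕ) :
    taylorCoeff f n = taylorCoeff g n := by
  rw [taylorCoeff, taylorCoeff, h.iteratedDeriv_eq]

theorem taylorCoeff_eq_of_hasSum {f : ℂ → ℂ} {c : ℕ → ℂ}
    (h : ∀ᶠ z in nhds 0, HasSum (fun n => c n * z ^ n) (f z)) (n : ℕ) :
    taylorCoeff f n = c n := by
  have h1 : HasFPowerSeriesAt f (FormalMultilinearSeries.ofScalars ℂ c) 0 := by
    rw [hasFPowerSeriesAt_iff]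
    filter_upwards [h] with z hz
    simpa [FormalMultilinearSeries.coeff_ofScalars, mul_comm] using hz
  have h2 := h1.analyticAt.hasFPowerSeriesAt
  have h3 := congrArg (fun p => p.coeff n) (h1.eq_formalMultilinearSeries h2)
  simpa [FormalMultilinearSeries.coeff_ofScalars, taylorCoeff] using h3.symm

theorem eventually_hasSum_taylorCoeff {f : ℂ → ℂ} (h : AnalyticAt ℂ f 0) :
    ∀ᶠ z in nhds 0, HasSum (fun n => taylorCoeff f n * z ^ n) (f z) := by
  have h1 := hasFPowerSeriesAt_iff.mp h.hasFPowerSeriesAt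
  filter_upwards [h1] with z hz
  simpa [FormalMultilinearSeries.coeff_ofScalars, taylorCoeff, mul_comm] using hz

theorem taylorCoeff_mul {f g : ℂ → ℂ} (hf : AnalyticAt ℂ f 0) (hg : AnalyticAt ℂ g 0) (n : ℕ) :
    taylorCoeff (f * g) n =
      ∑ i ∈ Finset.range (n + 1), taylorCoeff f i * taylorCoeff g (n - i) := by
  rw [taylorCoeff, iteratedDeriv_mul hf.contDiffAt hg.contDiffAt, Finset.sum_div]
  refine Finset.sum_congr rfl fun i hi => ?_
  have hi' : i ≤ n := Nat.lt_succ_iff.mp (Finset.mem_range.mp hi)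
  have h := Nat.choose_mul_factorial_mul_factorial hi'
  have h' : (n.choose i : ℂ) * i.factorial * (n - i).factorial = n.factorial := by exact_mod_cast h
  have h1 : (i.factorial : ℂ) ≠ 0 := by exact_mod_cast i.factorial_ne_zero
  have h2 : ((n - i).factorial : ℂ) ≠ 0 := by exact_mod_cast (n - i).factorial_ne_zero
  have h3 : (n.factorial : ℂ) ≠ 0 := by exact_mod_cast n.factorial_ne_zero
  rw [taylorCoeff, taylorCoeff]
  field_simp
  rw [← h']
  ring

theorem taylorCoeff_deriv (f : ℂ → ℂ) (n : ℕ) :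
    taylorCoeff (deriv f) n = (n + 1) * taylorCoeff f (n + 1) := by
  rw [taylorCoeff, taylorCoeff, iteratedDeriv_succ', Nat.factorial_succ]
  have h1 : (n.factorial : ℂ) ≠ 0 := by exact_mod_cast n.factorial_ne_zero
  have h2 : ((n : ℂ) + 1) ≠ 0 := by exact_mod_cast n.succ_ne_zero
  push_cast
  field_simp

theorem taylorCoeff_Xi_aux (n : ℕ) :
    taylorCoeff Xi n = if Even n then (-1) ^ (n / 2) * (a (n / 2) : ℂ) else 0 := by
  refine taylorCoeff_eq_of_hasSum
    (c := fun n => if Even n then (-1) ^ (n / 2) * (a (n / 2) : ℂ) else 0)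
    (Filter.Eventually.of_forall fun z => ?_) n
  have h := HasSum.even_add_odd (m := Xi z) (m' := 0)
    (f := fun n => (if Even n then (-1) ^ (n / 2) * (a (n / 2) : ℂ) else 0) * z ^ n) ?_ ?_
  · simpa only [add_zero] using h
  · simpa using hasSum_Xi z
  · simp

theorem taylorCoeff_Xi_even (n : ℕ) : taylorCoeff Xi (2 * n) = (-1) ^ n * (a n : ℂ) := by
  simp [taylorCoeff_Xi_aux]

theorem taylorCoeff_Xi_odd (n : ℕ) : taylorCoeff Xi (2 * n + 1) = 0 := by
  simp [taylorCoeff_Xi_aux]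

theorem m_eq_taylorCoeff (k : ℕ) : m k = -(taylorCoeff logDerivXi (2 * k + 3) / 2) := by
  rw [m, taylorCoeff]
  change _ * iteratedDeriv (2 * k + 3) logDerivXi 0 = _
  have h1 : ((2 * k + 3).factorial : ℂ) ≠ 0 := by exact_mod_cast (2 * k + 3).factorial_ne_zero
  field_simp

theorem sum_range_two_mul {M : Type*} [AddCommMonoid M] (g : ℕ → M) (n : ℕ) :
    ∑ i ∈ Finset.range (2 * n), g i = ∑ k ∈ Finset.range n, (g (2 * k) + g (2 * k + 1)) := by
  induction n with
  | zero => simp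
  | succ n ih =>
    rw [Finset.sum_range_succ, ← ih, show 2 * (n + 1) = 2 * n + 1 + 1 by ring,
      Finset.sum_range_succ, Finset.sum_range_succ, add_assoc]

/-- Coefficient of `s^(2N+1)` in `Ξ' = (Ξ'/Ξ) Ξ`; only the even coefficients of Ξ survive. -/
theorem sum_taylorCoeff_logDerivXi (N : ℕ) :
    ∑ k ∈ Finset.range (N + 1),
      taylorCoeff logDerivXi (2 * k + 1) * ((-1) ^ (N - k) * (a (N - k) : ℂ)) =
      (2 * N + 2) * ((-1) ^ (N + 1) * (a (N + 1) : ℂ)) := by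
  have h1 : deriv Xi =ᶠ[nhds 0] logDerivXi * Xi := by
    filter_upwards [eventually_Xi_ne_zero] with s hs
    simp [logDerivXi, hs]
  have h2 := taylorCoeff_congr h1 (2 * N + 1)
  rw [taylorCoeff_deriv, taylorCoeff_mul analyticAt_logDerivXi (differentiable_Xi.analyticAt 0),
    show 2 * N + 1 + 1 = 2 * (N + 1) by ring, sum_range_two_mul, taylorCoeff_Xi_even] at h2
  push_cast at h2
  rw [show (2 * (N : ℂ) + 2) = 2 * N + 1 + 1 by ring, h2]
  refine Finset.sum_congr rfl fun k hk => ?_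
  have hk' : k ≤ N := Nat.lt_succ_iff.mp (Finset.mem_range.mp hk)
  rw [show 2 * N + 1 - 2 * k = 2 * (N - k) + 1 by omega,
    show 2 * N - 2 * k = 2 * (N - k) by omega, taylorCoeff_Xi_even, taylorCoeff_Xi_odd,
    mul_zero, zero_add]

/-- The right-hand sides of the linear system satisfied by the numbers `(-1)^k m_k`. -/
noncomputable def momentRhs (n : ℕ) : ℝ :=
  a 1 * a (n + 1) / a 0 ^ 2 - ((n : ℝ) + 2) * a (n + 2) / a 0

theorem a_zero_ne : (a 0 : ℂ) ≠ 0 := by exact_mod_cast (a_pos 0).ne'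

theorem taylorCoeff_logDerivXi_one : taylorCoeff logDerivXi 1 = -2 * a 1 / a 0 := by
  have h0 := sum_taylorCoeff_logDerivXi 0
  simp only [zero_add, Finset.sum_range_one, Nat.sub_self, pow_zero, one_mul, mul_zero,
    pow_one, Nat.cast_zero] at h0
  rw [eq_div_iff a_zero_ne, h0]
  ring

/-- The preceding relation at `n + 1`: its term of index 0 carries the coefficient `-2a₁/a₀` and,
moved to the right, gives `a₁ a_{n+1} / a₀²`. -/
theorem sum_m_mul_a (n : ℕ) :
    ∑ k ∈ Finset.range (n + 1), (-1) ^ k * m k * (a (n - k) : ℂ) / (a 0 : ℂ) =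
      (momentRhs n : ℂ) := by
  have h := sum_taylorCoeff_logDerivXi (n + 1)
  rw [Finset.sum_range_succ'] at h
  have h2 : ∑ k ∈ Finset.range (n + 1), taylorCoeff logDerivXi (2 * (k + 1) + 1) *
      ((-1) ^ (n + 1 - (k + 1)) * (a (n + 1 - (k + 1)) : ℂ)) =
      -2 * (-1) ^ n * ∑ k ∈ Finset.range (n + 1), (-1) ^ k * m k * (a (n - k) : ℂ) := by
    rw [Finset.mul_sum]
    refine Finset.sum_congr rfl fun k hk => ?_
    have hk' : k ≤ n := Nat.lt_succ_iff.mp (Finset.mem_range.mp hk)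
    rw [m_eq_taylorCoeff, show 2 * (k + 1) + 1 = 2 * k + 3 by ring, Nat.add_sub_add_right]
    have : ((-1) ^ n : ℂ) = (-1) ^ (n - k) * (-1) ^ k := by rw [← pow_add, Nat.sub_add_cancel hk']
    have h' : ((-1) ^ k : ℂ) * (-1) ^ k = 1 := by rw [← mul_pow]; simp
    rw [this]
    linear_combination (-taylorCoeff logDerivXi (2 * k + 3) * (-1) ^ (n - k) * a (n - k)) * h'
  rw [h2] at h
  simp only [mul_zero, zero_add, Nat.sub_zero, taylorCoeff_logDerivXi_one] at h
  have hn : ((-1) ^ n : ℂ) * (-1) ^ n = 1 := by rw [← mul_pow]; simp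
  rw [← Finset.sum_div, div_eq_iff a_zero_ne, momentRhs]
  have ha := a_zero_ne
  push_cast at h ⊢
  generalize ∑ k ∈ Finset.range (n + 1), (-1) ^ k * m k * (a (n - k) : ℂ) = S at *
  have e : S = (-1) ^ n * (-1) ^ n * S := by rw [hn, one_mul]
  have e2 : (-1 : ℂ) ^ n * S = (-1) ^ n * (a 1 * a (n + 1) / a 0 - (n + 2) * a (n + 2)) := by
    rw [pow_succ, pow_succ] at h
    linear_combination (-1 / 2 : ℂ) * h
  rw [e, mul_assoc, e2, ← mul_assoc, hn]
  field_simp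

theorem m_recursion (n : ℕ) :
    (-1) ^ n * m n = (momentRhs n : ℂ) -
      ∑ k ∈ Finset.range n, (-1) ^ k * m k * (a (n - k) : ℂ) / (a 0 : ℂ) := by
  rw [← sum_m_mul_a n, Finset.sum_range_succ, Nat.sub_self, mul_div_cancel_right₀ _ a_zero_ne]
  ring

/-- Cramer's rule for the last unknown of the unit triangular system `T x = b`. -/
theorem m_eq_det (n : ℕ) : m n = (-1) ^ n * ((momentMatrix n).det : ℂ) := by
  let T : Matrix (Fin (n + 1)) (Fin (n + 1)) ℂ := Matrix.of fun i j =>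
    if j ≤ i then (a ((i : ℕ) - (j : ℕ)) : ℂ) / a 0 else 0
  let x : Fin (n + 1) → ℂ := fun k => (-1) ^ (k : ℕ) * m k
  let b : Fin (n + 1) → ℂ := fun k => (momentRhs k : ℂ)
  have ha := a_zero_ne
  have hTx : T.mulVec x = b := by
    ext i
    have h1 : T.mulVec x i = ∑ j : Fin (n + 1), (fun j : ℕ => if j ≤ (i : ℕ) then
        (-1) ^ j * m j * (a ((i : ℕ) - j) : ℂ) / a 0 else 0) j := by
      change ∑ j, T i j * x j = _
      refine Finset.sum_congr rfl fun j _ => ?_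
      simp only [T, x, Matrix.of_apply, Fin.le_def]
      split_ifs <;> ring
    rw [h1, Fin.sum_univ_eq_sum_range (fun j : ℕ => if j ≤ (i : ℕ) then
        (-1) ^ j * m j * (a ((i : ℕ) - j) : ℂ) / a 0 else 0), ← Finset.sum_filter]
    simp only [b]
    rw [← sum_m_mul_a i]
    refine Finset.sum_congr ?_ fun _ _ => rfl
    ext j
    simp only [Finset.mem_filter, Finset.mem_range]
    have := i.isLt
    omega
  have hdet : T.det = 1 := by
    rw [Matrix.det_of_isLowerTriangular]
    · refine Finset.prod_eq_one fun i _ => ?_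
      simp [T, ha]
    · intro i j hij
      have : ¬ j ≤ i := not_le.mpr hij
      simp [T, this]
  have hcr : T.cramer b (Fin.last n) = x (Fin.last n) := by
    rw [Matrix.cramer_eq_adjugate_mulVec, ← hTx, Matrix.mulVec_mulVec, Matrix.adjugate_mul, hdet,
      one_smul, Matrix.one_mulVec]
  have hM : T.updateCol (Fin.last n) b = (momentMatrix n).map Complex.ofRealHom := by
    ext i j
    simp only [momentMatrix, Matrix.updateCol_apply, Matrix.map_apply, Matrix.of_apply]
    by_cases hj : j = Fin.last n
    · simp [hj, b, momentRhs]
    · simp only [hj, if_false, T, Matrix.of_apply]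
      rcases lt_trichotomy j i with h | h | h
      · simp [h, h.le]
      · simp [h, ha]
      · simp [not_le.mpr h, not_lt.mpr h.le, h.ne']
  rw [Matrix.cramer_apply, hM] at hcr
  have h2 : ((momentMatrix n).det : ℂ) = ((momentMatrix n).map Complex.ofRealHom).det := by
    simpa using RingHom.map_det Complex.ofRealHom (momentMatrix n)
  rw [h2, hcr]
  simp only [x, Fin.val_last]
  rw [← mul_assoc, ← mul_pow]
  simp

/-! ### Dividing out zeros and estimating logarithmic derivatives. -/

theorem exists_factor_zero {g : ℂ → ℂ} (hg : Differentiable ℂ g) {w : ℂ} (hw : w ≠ 0)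
    (hgw : g w = 0) :
    ∃ g₁ : ℂ → ℂ, Differentiable ℂ g₁ ∧ ∀ s, g s = g₁ s * (1 - s / w) := by
  refine ⟨fun s => -w * dslope g w s, ?_, fun s => ?_⟩
  · have h : Differentiable ℂ (dslope g w) := by
      rw [← differentiableOn_univ, Complex.differentiableOn_dslope Filter.univ_mem]
      exact hg.differentiableOn
    exact h.const_mul _
  · have h := sub_smul_dslope g w s
    rw [hgw, sub_zero, smul_eq_mul] at h
    rw [← h]
    field_simp
    ring

/-- On the circle of radius `4R` each factor satisfies `|1 - s/z_j| ≥ 4 - 1 = 3`; the maximum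
principle carries the bound inside. -/
theorem norm_le_of_factorization {f g : ℂ → ℂ} (hg : Differentiable ℂ g) {R M : ℝ} (hR : 0 < R)
    (hM : ∀ s, ‖s‖ = 4 * R → ‖f s‖ ≤ M) {n : ℕ} {z : Fin n → ℂ}
    (hz : ∀ j, ‖z j‖ ≤ R ∧ z j ≠ 0) (hfg : ∀ s, f s = g s * ∏ j, (1 - s / z j)) {s : ℂ}
    (hs : ‖s‖ ≤ 4 * R) : ‖g s‖ ≤ M / 3 ^ n := by
  have hR4 : 4 * R ≠ 0 := by positivity
  refine Complex.norm_le_of_forall_mem_frontier_norm_le (U := Metric.ball 0 (4 * R))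
    Metric.isBounded_ball hg.diffContOnCl (fun w hw => ?_) ?_
  · rw [frontier_ball _ hR4, mem_sphere_zero_iff_norm] at hw
    have h := hM w hw
    rw [hfg w, norm_mul, norm_prod] at h
    rw [le_div_iff₀ (by positivity)]
    refine le_trans (mul_le_mul_of_nonneg_left ?_ (norm_nonneg _)) h
    calc (3 : ℝ) ^ n = ∏ _j : Fin n, 3 := by simp
      _ ≤ ∏ j, ‖1 - w / z j‖ := by
        refine Finset.prod_le_prod (fun _ _ => by norm_num) fun j _ => ?_
        have h1 : 4 ≤ ‖w / z j‖ := by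
          rw [norm_div, hw, le_div_iff₀ (norm_pos_iff.mpr (hz j).2)]
          linarith [(hz j).1]
        have h2 := norm_sub_norm_le (w / z j) 1
        rw [norm_one, norm_sub_rev] at h2
        linarith
  · rw [closure_ball _ hR4]
    simpa using hs

/-- Dividing an entire function by its zeros in a disc. -/
theorem exists_zero_factorization {f : ℂ → ℂ} (hf : Differentiable ℂ f) (hf0 : f 0 ≠ 0)
    {R M : ℝ} (hR : 0 < R) (hM : ∀ s, ‖s‖ = 4 * R → ‖f s‖ ≤ M) :
    ∃ (n : ℕ) (z : Fin n → ℂ) (g : ℂ → ℂ), Differentiable ℂ g ∧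
      (∀ j, f (z j) = 0 ∧ ‖z j‖ ≤ R ∧ z j ≠ 0) ∧ (∀ s, f s = g s * ∏ j, (1 - s / z j)) ∧
      (∀ s, ‖s‖ ≤ R → g s ≠ 0) ∧ ∀ s, ‖s‖ ≤ 4 * R → ‖g s‖ ≤ M := by
  -- Otherwise zeros could be split off forever, and `|f(0)| = |g(0)| ≤ M / 3^n` for every `n` would
  -- force `f(0) = 0`.
  by_contra hcon
  have hM0 : 0 ≤ M := (norm_nonneg _).trans (hM ((4 * R : ℝ) : ℂ) (by
    rw [Complex.norm_real, Real.norm_of_nonneg (by positivity)]))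
  have hall : ∀ n : ℕ, ∃ (z : Fin n → ℂ) (g : ℂ → ℂ), Differentiable ℂ g ∧
      (∀ j, f (z j) = 0 ∧ ‖z j‖ ≤ R ∧ z j ≠ 0) ∧ (∀ s, f s = g s * ∏ j, (1 - s / z j)) := by
    intro n
    induction n with
    | zero => exact ⟨fun j => j.elim0, f, hf, fun j => j.elim0, fun s => by simp⟩
    | succ n ih =>
      obtain ⟨z, g, hg, hz, hfg⟩ := ih
      have hex : ∃ w, ‖w‖ ≤ R ∧ g w = 0 := by
        by_contra hno
        push Not at hno
        refine hcon ⟨n, z, g, hg, hz, hfg, hno, fun s hs => ?_⟩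
        exact (norm_le_of_factorization hg hR hM (fun j => (hz j).2) hfg hs).trans
          (div_le_self hM0 (one_le_pow₀ (by norm_num)))
      obtain ⟨w, hwR, hgw⟩ := hex
      have hw0 : w ≠ 0 := by
        rintro rfl
        exact hf0 (by rw [hfg, hgw, zero_mul])
      obtain ⟨g₁, hg₁, hgg⟩ := exists_factor_zero hg hw0 hgw
      refine ⟨Fin.snoc z w, g₁, hg₁, fun j => ?_, fun s => ?_⟩
      · refine Fin.lastCases ?_ (fun j => ?_) j
        · simp only [Fin.snoc_last]
          exact ⟨by rw [hfg, hgw, zero_mul], hwR, hw0⟩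
        · simp only [Fin.snoc_castSucc]
          exact hz j
      · rw [hfg, hgg, Fin.prod_univ_castSucc]
        simp only [Fin.snoc_last, Fin.snoc_castSucc]
        ring
  obtain ⟨n, hn⟩ := pow_unbounded_of_one_lt (M / ‖f 0‖) (by norm_num : (1 : ℝ) < 3)
  obtain ⟨z, g, hg, hz, hfg⟩ := hall n
  have h := norm_le_of_factorization hg hR hM (fun j => (hz j).2) hfg
    (s := 0) (by simpa using hR.le)
  have h0 : f 0 = g 0 := by simpa using hfg 0
  rw [← h0, le_div_iff₀ (by positivity)] at h
  rw [div_lt_iff₀ (norm_pos_iff.mpr hf0)] at hn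
  linarith

/-- A primitive `h` of `g'/g` with `h(0) = 0` is a logarithm of `g/g(0)`, so `Re h ≤ log(M/|g(0)|)`.
Borel-Carathéodory bounds `|h|` by twice this on the circle of radius `R/2`, and Cauchy's estimate
there bounds the coefficient of order `N + 1` of `h`. -/
theorem norm_taylorCoeff_logDeriv_le {g : ℂ → ℂ} (hg : Differentiable ℂ g) {R M : ℝ} (hR : 0 < R)
    (hne : ∀ s, ‖s‖ < R → g s ≠ 0) (hM : ∀ s, ‖s‖ < R → ‖g s‖ ≤ M) (hM0 : ‖g 0‖ < M) (N : ℕ) :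
    ‖taylorCoeff (fun s => deriv g s / g s) N‖ ≤
      (N + 1) * (2 * Real.log (M / ‖g 0‖)) * (2 / R) ^ (N + 1) := by
  have hg0 : g 0 ≠ 0 := hne 0 (by simpa using hR)
  have hg0' : 0 < ‖g 0‖ := norm_pos_iff.mpr hg0
  have hA : 0 < Real.log (M / ‖g 0‖) := Real.log_pos ((one_lt_div hg0').mpr hM0)
  have hd : DifferentiableOn ℂ (fun s => deriv g s / g s) (Metric.ball 0 R) := by
    refine DifferentiableOn.div ?_ hg.differentiableOn fun s hs => hne s (by simpa using hs)
    exact (hg.contDiff (n := 2)).differentiable_deriv_two.differentiableOn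
  obtain ⟨h, hh0, hh⟩ := hd.isExactOn_ball.with_val_at 0 0
  have hconst : ∀ s ∈ Metric.ball (0 : ℂ) R, g s * Complex.exp (-h s) = g 0 := by
    intro s hs
    have h0 : (0 : ℂ) ∈ Metric.ball (0 : ℂ) R := by simpa using hR
    have hder : ∀ x ∈ Metric.ball (0 : ℂ) R,
        HasDerivAt (fun s => g s * Complex.exp (-h s)) 0 x := by
      intro x hx
      have h1 := (hg x).hasDerivAt.mul (hh x hx).neg.cexp
      convert! h1 using 1
      have := hne x (by simpa using hx)
      simp only [Pi.neg_apply]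
      field_simp
      ring
    have := (convex_ball (0 : ℂ) R).is_const_of_fderivWithin_eq_zero (𝕜 := ℂ)
      (f := fun s => g s * Complex.exp (-h s))
      (fun x hx => (hder x hx).differentiableAt.differentiableWithinAt) (fun x hx => by
        rw [fderivWithin_of_isOpen Metric.isOpen_ball hx]
        ext
        simpa using (hder x hx).deriv) hs h0
    simpa [hh0] using this
  have hre : Set.MapsTo h (Metric.ball 0 R) {z | z.re ≤ Real.log (M / ‖g 0‖)} := by
    intro s hs
    have h1 := congrArg norm (hconst s hs)
    rw [norm_mul, Complex.norm_exp, Complex.neg_re] at h1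
    have hgs := norm_pos_iff.mpr (hne s (by simpa using hs))
    have h2 : Real.exp (h s).re = ‖g s‖ / ‖g 0‖ := by
      rw [← h1, Real.exp_neg]
      field_simp
    have hMpos : 0 < M := hg0'.trans hM0
    rw [Set.mem_ofPred_eq, Real.le_log_iff_exp_le (by positivity), h2]
    have := hM s (by simpa using hs)
    gcongr
  have hdh : DifferentiableOn ℂ h (Metric.ball 0 R) := fun s hs =>
    (hh s hs).differentiableAt.differentiableWithinAt
  have hbound : ∀ s ∈ Metric.sphere (0 : ℂ) (R / 2), ‖h s‖ ≤ 2 * Real.log (M / ‖g 0‖) := by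
    intro s hs
    rw [mem_sphere_zero_iff_norm] at hs
    have h1 := Complex.borelCaratheodory_zero hA hdh hre hR (z := s) (by simp [hs, hR]) hh0
    rw [hs] at h1
    convert! h1 using 1
    field_simp
    ring
  have hcauchy := Complex.norm_iteratedDeriv_le_of_forall_mem_sphere_norm_le (N + 1) (half_pos hR)
    (DifferentiableOn.diffContOnCl_ball hdh (Metric.closedBall_subset_ball (half_lt_self hR)))
    hbound
  have heq : (fun s => deriv g s / g s) =ᶠ[nhds 0] deriv h := by
    filter_upwards [Metric.ball_mem_nhds (0 : ℂ) hR] with s hs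
    exact (hh s hs).deriv.symm
  rw [taylorCoeff_congr heq, taylorCoeff_deriv, taylorCoeff, norm_mul, norm_div,
    Complex.norm_natCast]
  have hN : ‖(N : ℂ) + 1‖ = N + 1 := by exact_mod_cast Complex.norm_natCast (N + 1)
  rw [hN, mul_assoc]
  refine mul_le_mul_of_nonneg_left ?_ (by positivity)
  rw [div_le_iff₀ (by positivity)]
  refine hcauchy.trans (le_of_eq ?_)
  rw [div_pow, div_pow]
  field_simp

theorem taylorCoeff_logDeriv_of_factorization {f g : ℂ → ℂ} (hg : Differentiable ℂ g)
    (hg0 : g 0 ≠ 0) {n : ℕ} {z : Fin n → ℂ}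
    (hfg : ∀ s, f s = g s * ∏ j, (1 - s / z j)) (N : ℕ) :
    taylorCoeff (fun s => deriv f s / f s) N =
      taylorCoeff (fun s => deriv g s / g s) N - ∑ j, (1 / z j) ^ (N + 1) := by
  refine taylorCoeff_eq_of_hasSum (c := fun N => taylorCoeff (fun s => deriv g s / g s) N -
    ∑ j, (1 / z j) ^ (N + 1)) ?_ N
  have hag : AnalyticAt ℂ g 0 := hg.analyticAt 0
  have h1 := eventually_hasSum_taylorCoeff (hag.deriv.div hag hg0)
  have h2 : ∀ᶠ s in nhds (0 : ℂ), ∀ j, ‖s / z j‖ < 1 := by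
    refine Filter.eventually_all.mpr fun j => ?_
    have : ContinuousAt (fun s : ℂ => ‖s / z j‖) 0 := by fun_prop
    refine this.eventually_lt continuousAt_const ?_
    simp
  filter_upwards [h1, h2, hg.continuous.continuousAt.eventually_ne hg0] with s hs1 hs2 hs3
  have hne : ∀ j, 1 - s / z j ≠ 0 := fun j h => by
    have h3 := hs2 j
    rw [← sub_eq_zero.mp h, norm_one] at h3
    exact lt_irrefl _ h3
  have hsum : ∀ j, HasSum (fun N : ℕ => (1 / z j) ^ (N + 1) * s ^ N)
      ((1 / z j) * (1 - s / z j)⁻¹) := by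
    intro j
    have h := (hasSum_geometric_of_norm_lt_one (hs2 j)).mul_left (1 / z j)
    convert! h using 2 with N
    simp only [div_eq_mul_inv, one_mul, mul_pow, pow_succ]
    ring
  have hld : deriv f s / f s = deriv g s / g s - ∑ j, (1 / z j) * (1 - s / z j)⁻¹ := by
    have hf : f = fun s => g s * ∏ j, (1 - s / z j) := funext hfg
    have hdj : ∀ j, HasDerivAt (fun s : ℂ => 1 - s / z j) (-(1 / z j)) s := fun j =>
      ((hasDerivAt_id s).div_const (z j)).const_sub 1
    have h4 := logDeriv_mul (f := g) (g := fun s => ∏ j, (1 - s / z j)) s hs3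
      (Finset.prod_ne_zero_iff.mpr fun j _ => hne j) (hg s) (by fun_prop)
    rw [← hf, logDeriv_prod (fun j _ => hne j) (fun j _ => (hdj j).differentiableAt)] at h4
    simp only [logDeriv_apply] at h4
    rw [h4, sub_eq_add_neg, ← Finset.sum_neg_distrib]
    congr 1
    refine Finset.sum_congr rfl fun j _ => ?_
    rw [(hdj j).deriv, div_eq_mul_inv, neg_mul]
  rw [hld]
  have h5 := hs1.sub (hasSum_sum (s := Finset.univ) fun j _ => hsum j)
  simp only [Pi.div_apply] at h5
  convert! h5 using 2 with N
  rw [sub_mul, Finset.sum_mul]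
  rfl

/-- The Taylor coefficients of the logarithmic derivative of an entire function are, up to an error
controlled by its growth, the power sums of the inverses of its zeros. -/
theorem exists_zeros_taylorCoeff_logDeriv {f : ℂ → ℂ} (hf : Differentiable ℂ f) (hf0 : f 0 ≠ 0)
    {R M : ℝ} (hR : 0 < R) (hM : ∀ s, ‖s‖ = 4 * R → ‖f s‖ ≤ M) (hM0 : ‖f 0‖ < M) :
    ∃ (n : ℕ) (z : Fin n → ℂ), (∀ j, f (z j) = 0 ∧ z j ≠ 0) ∧
      ∀ N, ‖taylorCoeff (fun s => deriv f s / f s) N + ∑ j, (1 / z j) ^ (N + 1)‖ ≤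
        (N + 1) * (2 * Real.log (M / ‖f 0‖)) * (2 / R) ^ (N + 1) := by
  obtain ⟨n, z, g, hg, hz, hfg, hne, hgM⟩ := exists_zero_factorization hf hf0 hR hM
  refine ⟨n, z, fun j => ⟨(hz j).1, (hz j).2.2⟩, fun N => ?_⟩
  have h0 : f 0 = g 0 := by simpa using hfg 0
  rw [taylorCoeff_logDeriv_of_factorization hg (h0 ▸ hf0) hfg,
    sub_add_cancel, h0]
  exact norm_taylorCoeff_logDeriv_le hg hR (fun s hs => hne s hs.le)
    (fun s hs => hgM s (by linarith)) (h0 ▸ hM0) N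

/-! ### Growth of Ξ and power sums over its zeros. -/

theorem norm_Xi_le {s : ℂ} {r : ℝ} (hs : ‖s‖ ≤ r) : ‖Xi s‖ ≤ (xi (1 / 2 + r)).re := by
  have h1 := hasSum_Xi s
  have h2 := Complex.hasSum_re (hasSum_xi (r : ℂ))
  have h3 : ∀ n : ℕ, ((a n : ℂ) * (r : ℂ) ^ (2 * n)).re = a n * r ^ (2 * n) := by
    intro n
    rw [← Complex.ofReal_pow, ← Complex.ofReal_mul, Complex.ofReal_re]
  simp_rw [h3] at h2
  rw [← h1.tsum_eq, ← h2.tsum_eq]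
  refine tsum_of_norm_bounded h2.summable.hasSum fun n => ?_
  have := a_pos n
  simp only [norm_mul, norm_pow, norm_neg, norm_one, one_pow, one_mul, Complex.norm_real,
    Real.norm_of_nonneg this.le]
  gcongr

theorem exists_norm_Xi_le : ∃ K : ℝ, 0 < K ∧ ‖Xi 0‖ < K ∧ ∀ (k : ℕ) (s : ℂ), ‖s‖ ≤ 4 * k →
    ‖Xi s‖ ≤ K * (2 * (k : ℝ) + 1) ^ (2 * k + 2) := by
  have hZ := tsum_one_div_nat_add_one_rpow_pos (show (1 : ℝ) < 2 by norm_num)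
  set Z := ∑' n : ℕ, 1 / ((n : ℝ) + 1) ^ (2 : ℝ) with hZdef
  refine ⟨4 * Z + ‖Xi 0‖, by positivity, by linarith, fun k s hs => ?_⟩
  -- This radius is at least `4k`, and `1/2 + r = 2(2k + 1)` turns the Gamma factor into `(2k +
  -- 1)!`.
  have h := norm_Xi_le (s := s) (r := 2 * (2 * k + 1) - 1 / 2) (by linarith)
  have hσ : (1 : ℝ) < 2 * (2 * k + 1) := by
    have : (0 : ℝ) ≤ k := k.cast_nonneg
    linarith
  have h1 : (1 / 2 : ℂ) + ((2 * (2 * k + 1) - 1 / 2 : ℝ) : ℂ) = ((2 * (2 * k + 1) : ℝ) : ℂ) := by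
    push_cast
    ring
  rw [h1, xi_ofReal hσ, Complex.ofReal_re] at h
  have hG : Real.Gamma (1 + 2 * (2 * (k : ℝ) + 1) / 2) = ((2 * k + 1).factorial : ℝ) := by
    rw [← Real.Gamma_nat_eq_factorial]
    congr 1
    push_cast
    ring
  have hpi : Real.pi ^ (-(2 * (2 * (k : ℝ) + 1)) / 2) ≤ 1 :=
    Real.rpow_le_one_of_one_le_of_nonpos (by linarith [Real.pi_gt_three]) (by linarith)
  have hz : ∑' n : ℕ, 1 / ((n : ℝ) + 1) ^ (2 * (2 * (k : ℝ) + 1)) ≤ Z := by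
    refine Summable.tsum_le_tsum (fun n => ?_) (summable_one_div_nat_add_one_rpow hσ)
      (summable_one_div_nat_add_one_rpow one_lt_two)
    have h0 : (0 : ℝ) ≤ k := k.cast_nonneg
    refine one_div_le_one_div_of_le (by positivity) ?_
    exact Real.rpow_le_rpow_of_exponent_le (by simp) (by linarith)
  have hfac : ((2 * k + 1).factorial : ℝ) ≤ (2 * (k : ℝ) + 1) ^ (2 * k + 1) := by
    exact_mod_cast Nat.factorial_le_pow (2 * k + 1)
  have hk1 : (1 : ℝ) ≤ (2 * (k : ℝ) + 1) := by simp
  rw [hG] at h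
  refine h.trans ?_
  have hσ' : 0 ≤ 2 * (2 * (k : ℝ) + 1) - 1 := by linarith
  calc _ ≤ 1 * (2 * (2 * (k : ℝ) + 1) - 1) * (2 * (k : ℝ) + 1) ^ (2 * k + 1) * Z := by
        have h0 : 0 ≤ ∑' n : ℕ, 1 / ((n : ℝ) + 1) ^ (2 * (2 * (k : ℝ) + 1)) :=
          (tsum_one_div_nat_add_one_rpow_pos hσ).le
        gcongr
    _ ≤ (4 * (2 * (k : ℝ) + 1)) * (2 * (k : ℝ) + 1) ^ (2 * k + 1) * Z := by
        rw [one_mul]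
        gcongr
        linarith
    _ = 4 * Z * (2 * (k : ℝ) + 1) ^ (2 * k + 2) := by ring
    _ ≤ _ := by
        gcongr
        linarith [norm_nonneg (Xi 0)]

open Filter in
theorem tendsto_log_div_sq (c : ℝ) :
    Tendsto (fun k : ℕ => (c + (2 * (k : ℝ) + 2) * Real.log (2 * (k : ℝ) + 1)) * (2 / (k : ℝ)) ^ 2)
      atTop (nhds 0) := by
  have h1 : Tendsto (fun k : ℕ => 2 * (k : ℝ) + 1) atTop atTop :=
    tendsto_atTop_add_const_right _ _ (tendsto_natCast_atTop_atTop.const_mul_atTop two_pos)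
  have h2 : Tendsto (fun k : ℕ => Real.log (2 * (k : ℝ) + 1) / (2 * (k : ℝ) + 1)) atTop
      (nhds 0) := by
    have h := Real.isLittleO_log_id_atTop.tendsto_div_nhds_zero.comp h1
    exact h
  have h3 : Tendsto (fun k : ℕ => (k : ℝ)⁻¹) atTop (nhds 0) :=
    tendsto_inv_atTop_zero.comp tendsto_natCast_atTop_atTop
  have h4 : Tendsto (fun k : ℕ => 4 * c * (k : ℝ)⁻¹ ^ 2 + 4 * (2 + 2 * (k : ℝ)⁻¹) *
      (2 + (k : ℝ)⁻¹) * (Real.log (2 * (k : ℝ) + 1) / (2 * (k : ℝ) + 1))) atTop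
      (nhds (4 * c * 0 ^ 2 + 4 * (2 + 2 * 0) * (2 + 0) * 0)) :=
    ((h3.pow 2).const_mul _).add ((((h3.const_mul 2).const_add 2).const_mul 4).mul
      (h3.const_add 2) |>.mul h2)
  have h5 : 4 * c * 0 ^ 2 + 4 * (2 + 2 * 0) * (2 + 0) * 0 = (0 : ℝ) := by ring
  rw [h5] at h4
  refine h4.congr' ?_
  filter_upwards [eventually_gt_atTop 0] with k hk
  have hk' : (0 : ℝ) < k := by exact_mod_cast hk
  field_simp
  ring

/-- With `R = k` the logarithm of the bound for Ξ is of size `k log k`, while `(2/k)^(N+1) ≤ (2/k)²`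
for `N ≥ 1`; the error tends to 0 by `tendsto_log_div_sq`. -/
theorem exists_zeros_approx_taylorCoeff (K : ℕ) {ε : ℝ} (hε : 0 < ε) :
    ∃ (n : ℕ) (z : Fin n → ℂ), (∀ j, Xi (z j) = 0 ∧ z j ≠ 0) ∧
      ∀ N, 1 ≤ N → N ≤ K → ‖taylorCoeff logDerivXi N + ∑ j, (1 / z j) ^ (N + 1)‖ < ε := by
  obtain ⟨C, hC, hC0, hCb⟩ := exists_norm_Xi_le
  have h0 : 0 < ‖Xi 0‖ := norm_pos_iff.mpr Xi_zero_ne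
  have ht := (tendsto_log_div_sq (Real.log (C / ‖Xi 0‖))).const_mul (((K : ℝ) + 1) * 2)
  rw [mul_zero] at ht
  obtain ⟨k, hkε, hk2⟩ := ((ht.eventually (gt_mem_nhds hε)).and
    (Filter.eventually_ge_atTop 2)).exists
  have hk : (2 : ℝ) ≤ k := by exact_mod_cast hk2
  have hkpos : (0 : ℝ) < k := by linarith
  have hone : (1 : ℝ) ≤ (2 * (k : ℝ) + 1) ^ (2 * k + 2) := one_le_pow₀ (by linarith)
  have hMlt : ‖Xi 0‖ < C * (2 * (k : ℝ) + 1) ^ (2 * k + 2) :=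
    hC0.trans_le (le_mul_of_one_le_right hC.le hone)
  obtain ⟨n, z, hz, hb⟩ := exists_zeros_taylorCoeff_logDeriv differentiable_Xi Xi_zero_ne hkpos
    (M := C * (2 * (k : ℝ) + 1) ^ (2 * k + 2)) (fun s hs => hCb k s hs.le) hMlt
  refine ⟨n, z, hz, fun N hN1 hNK => (hb N).trans_lt (lt_of_le_of_lt ?_ hkε)⟩
  have hlog : Real.log (C * (2 * (k : ℝ) + 1) ^ (2 * k + 2) / ‖Xi 0‖) =
      Real.log (C / ‖Xi 0‖) + (2 * (k : ℝ) + 2) * Real.log (2 * (k : ℝ) + 1) := by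
    rw [mul_div_right_comm, Real.log_mul (by positivity) (by positivity), Real.log_pow]
    push_cast
    ring
  have hlogpos : 0 ≤ Real.log (C * (2 * (k : ℝ) + 1) ^ (2 * k + 2) / ‖Xi 0‖) :=
    Real.log_nonneg ((one_le_div h0).mpr hMlt.le)
  rw [← hlog, ← mul_assoc, ← mul_assoc]
  have hp : (2 / (k : ℝ)) ^ (N + 1) ≤ (2 / (k : ℝ)) ^ 2 :=
    pow_le_pow_of_le_one (by positivity) ((div_le_one hkpos).mpr hk) (by omega)
  have hNK' : (N : ℝ) ≤ K := by exact_mod_cast hNK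
  gcongr

/-- Without zeros the approximating power sums are empty, contradicting that the first coefficient
`-2a₁/a₀` is nonzero. -/
theorem exists_Xi_eq_zero : ∃ z, Xi z = 0 := by
  by_contra! hno
  have h1 : taylorCoeff logDerivXi 1 ≠ 0 := by
    rw [taylorCoeff_logDerivXi_one]
    have : (a 1 : ℂ) ≠ 0 := by exact_mod_cast (a_pos 1).ne'
    have := a_zero_ne
    positivity
  obtain ⟨n, z, hz, hb⟩ := exists_zeros_approx_taylorCoeff 1 (norm_pos_iff.mpr h1)
  have hn : IsEmpty (Fin n) := ⟨fun j => hno _ (hz j).1⟩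
  have := hb 1 le_rfl le_rfl
  simp at this

theorem exists_zeros_approx_m (K : ℕ) {ε : ℝ} (hε : 0 < ε) :
    ∃ (n : ℕ) (z : Fin n → ℂ), (∀ j, Xi (z j) = 0 ∧ z j ≠ 0) ∧
      ∀ i ≤ K, ‖m i - (∑ j, (1 / z j ^ 2) ^ (i + 2)) / 2‖ < ε := by
  obtain ⟨n, z, hz, hb⟩ := exists_zeros_approx_taylorCoeff (2 * K + 3) hε
  refine ⟨n, z, hz, fun i hi => ?_⟩
  have h := hb (2 * i + 3) (by omega) (by omega)
  have h2 : m i - (∑ j, (1 / z j ^ 2) ^ (i + 2)) / 2 = -((taylorCoeff logDerivXi (2 * i + 3) +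
      ∑ j, (1 / z j) ^ (2 * i + 3 + 1)) / 2) := by
    rw [m_eq_taylorCoeff]
    have : ∀ j, (1 / z j ^ 2) ^ (i + 2) = (1 / z j) ^ (2 * i + 3 + 1) := by
      intro j
      rw [one_div, one_div, inv_pow, inv_pow, ← pow_mul]
      ring_nf
    simp_rw [this]
    ring
  rw [h2, norm_neg, norm_div, Complex.norm_ofNat]
  linarith [norm_nonneg (taylorCoeff logDerivXi (2 * i + 3) + ∑ j, (1 / z j) ^ (2 * i + 3 + 1))]

/-! ### Location of the zeros of Ξ and the Riemann hypothesis. -/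

theorem xi_ne_zero_of_one_lt_re {s : ℂ} (hs : 1 < s.re) : xi s ≠ 0 := by
  have h1 : s ≠ 1 := by
    rintro rfl
    simp at hs
  rw [xi_eq h1 fun n hn => by
    rw [hn] at hs
    simp at hs
    have : (0 : ℝ) ≤ n := n.cast_nonneg
    linarith]
  have hG : Complex.Gamma (1 + s / 2) ≠ 0 := by
    refine Complex.Gamma_ne_zero_of_re_pos ?_
    simp only [Complex.add_re, Complex.one_re, Complex.div_ofNat_re]
    linarith
  have hpi : (Real.pi : ℂ) ^ (-s / 2) ≠ 0 := by
    simp [Complex.cpow_eq_zero_iff, Real.pi_ne_zero]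
  exact mul_ne_zero (mul_ne_zero (mul_ne_zero hpi (sub_ne_zero.mpr h1)) hG)
    (riemannZeta_ne_zero_of_one_lt_re hs)

theorem neg_half_le_im_of_Xi_eq_zero {z : ℂ} (hz : Xi z = 0) : -(1 / 2) ≤ z.im := by
  by_contra! h
  refine xi_ne_zero_of_one_lt_re (s := 1 / 2 + Complex.I * z) ?_ hz
  have : (1 / 2 + Complex.I * z).re = 1 / 2 - z.im := by simp [sub_eq_add_neg]
  rw [this]
  linarith

theorem abs_im_le_of_Xi_eq_zero {z : ℂ} (hz : Xi z = 0) : |z.im| ≤ 1 / 2 := by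
  have h1 := neg_half_le_im_of_Xi_eq_zero hz
  have h2 := neg_half_le_im_of_Xi_eq_zero ((Xi_neg z).trans hz)
  rw [Complex.neg_im] at h2
  exact abs_le.mpr ⟨h1, by linarith⟩

/-- At real `y` all terms of the even series are nonnegative and `a₀ > 0`. This keeps zeros of Ξ off
the imaginary axis, and zeros of ξ away from 1 and the trivial zeros of ζ. -/
theorem xi_half_add_ofReal_ne_zero (y : ℝ) : xi (1 / 2 + y) ≠ 0 := by
  intro h0
  have h := hasSum_xi (y : ℂ)
  rw [h0] at h
  have h2 : HasSum (fun n : ℕ => a n * y ^ (2 * n)) 0 := by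
    have := Complex.hasSum_re h
    convert! this using 2 with n
    rw [← Complex.ofReal_pow, ← Complex.ofReal_mul, Complex.ofReal_re]
  have hpos : ∀ n : ℕ, 0 ≤ a n * y ^ (2 * n) := fun n =>
    mul_nonneg (a_pos n).le (Even.pow_nonneg (even_two_mul n) y)
  have h3 := h2.summable.tsum_pos hpos 0 (by simpa using a_pos 0)
  rw [h2.tsum_eq] at h3
  exact lt_irrefl _ h3

theorem re_ne_zero_of_Xi_eq_zero {z : ℂ} (hz : Xi z = 0) : z.re ≠ 0 := by
  intro h
  refine xi_half_add_ofReal_ne_zero (-z.im) ?_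
  have h1 : ((-z.im : ℝ) : ℂ) = Complex.I * z := by
    apply Complex.ext <;> simp [h]
  rw [h1]
  exact hz

theorem positiveZeroRealParts_nonempty : positiveZeroRealParts.Nonempty := by
  obtain ⟨z, hz⟩ := exists_Xi_eq_zero
  rcases lt_or_gt_of_ne (re_ne_zero_of_Xi_eq_zero hz) with h | h
  · exact ⟨(-z).re, by simpa using h, -z, (Xi_neg z).trans hz, rfl⟩
  · exact ⟨z.re, h, z, hz, rfl⟩

theorem exists_isLeast_positiveZeroRealParts : ∃ s₁, IsLeast positiveZeroRealParts s₁ := by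
  obtain ⟨t, ht, z₀, hz₀, hz₀t⟩ := positiveZeroRealParts_nonempty
  -- Zeros have imaginary part at most 1/2 in absolute value, so those with `0 ≤ Re z ≤ t` form a
  -- compact set; including `Re z = 0` adds none.
  have hcomp : IsCompact {z : ℂ | Xi z = 0 ∧ 0 ≤ z.re ∧ z.re ≤ t} := by
    refine Metric.isCompact_of_isClosed_isBounded ?_ ?_
    · refine (isClosed_eq differentiable_Xi.continuous continuous_const).inter
        ((isClosed_le continuous_const Complex.continuous_re).inter
          (isClosed_le Complex.continuous_re continuous_const))
    · refine (Metric.isBounded_closedBall (x := (0 : ℂ)) (r := t + 1 / 2)).subset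
        fun z hz => ?_
      rw [mem_closedBall_zero_iff]
      have h1 := abs_im_le_of_Xi_eq_zero hz.1
      have h2 := Complex.norm_le_abs_re_add_abs_im z
      rw [abs_of_nonneg hz.2.1] at h2
      linarith [hz.2.2]
  obtain ⟨z, hz, hmin⟩ := hcomp.exists_isMinOn ⟨z₀, hz₀, hz₀t ▸ ht.le, hz₀t.le⟩
    Complex.continuous_re.continuousOn
  have hzpos : 0 < z.re := lt_of_le_of_ne hz.2.1 (re_ne_zero_of_Xi_eq_zero hz.1).symm
  refine ⟨z.re, ⟨hzpos, z, hz.1, rfl⟩, ?_⟩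
  rintro x ⟨hx, w, hw, rfl⟩
  rcases le_total w.re t with h | h
  · exact hmin ⟨hw, hx.le, h⟩
  · exact hz.2.2.trans h

theorem riemannHypothesis_iff : RiemannHypothesis ↔ ∀ z, Xi z = 0 → z.im = 0 := by
  have hre : ∀ z : ℂ, (1 / 2 + Complex.I * z).re = 1 / 2 - z.im := by
    intro z
    simp [sub_eq_add_neg]
  constructor
  · intro hRH z hz
    have hreal : ∀ y : ℝ, 1 / 2 + Complex.I * z ≠ (y : ℂ) := by
      intro y hy
      refine xi_half_add_ofReal_ne_zero (y - 1 / 2) ?_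
      rw [Xi, hy] at hz
      rw [← hz]
      congr 1
      push_cast
      ring
    have h1 : 1 / 2 + Complex.I * z ≠ 1 := by simpa using hreal 1
    have h2 : ∀ n : ℕ, 1 / 2 + Complex.I * z ≠ -2 * (n + 1) := by
      intro n hn
      refine hreal (-2 * (n + 1)) ?_
      rw [hn]
      push_cast
      rfl
    have h3 := xi_eq h1 h2
    have hx : xi (1 / 2 + Complex.I * z) = 0 := hz
    set s := 1 / 2 + Complex.I * z with hs
    have hG : Complex.Gamma (1 + s / 2) ≠ 0 := by
      refine Complex.Gamma_ne_zero fun n hn => ?_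
      rcases n with _ | n
      · refine hreal (-2) ?_
        push_cast at hn ⊢
        linear_combination 2 * hn
      · refine hreal (-2 * (n + 2)) ?_
        push_cast at hn ⊢
        linear_combination 2 * hn
    have hpi : (Real.pi : ℂ) ^ (-s / 2) ≠ 0 := by
      simp [Complex.cpow_eq_zero_iff, Real.pi_ne_zero]
    rw [hx] at h3
    have hζ : riemannZeta s = 0 := by
      rcases mul_eq_zero.mp h3.symm with h | h
      · exact absurd h (mul_ne_zero (mul_ne_zero hpi (sub_ne_zero.mpr h1)) hG)
      · exact h
    have h4 := hRH s hζ (fun ⟨n, hn⟩ => h2 n hn) h1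
    rw [hs, hre] at h4
    linarith
  · intro h s hζ htriv h1
    have hx : xi s = 0 := by
      rw [xi_eq h1 fun n hn => htriv ⟨n, hn⟩, hζ, mul_zero]
    have hs : s = 1 / 2 + Complex.I * (-Complex.I * (s - 1 / 2)) := by
      rw [← mul_assoc, mul_neg, Complex.I_mul_I]
      ring
    have h2 := h (-Complex.I * (s - 1 / 2)) (by rw [Xi, ← hs, hx])
    have h3 := congrArg Complex.re hs
    rw [hre, h2] at h3
    linarith

/-! ### From the Riemann hypothesis to the moment inequalities. -/

theorem moment_nonneg_of_riemannHypothesis (hRH : RiemannHypothesis) {s₁ L : ℝ}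
    (hs₁ : IsLeast positiveZeroRealParts s₁) (hL : (s₁ ^ 2)⁻¹ < L) (n k : ℕ) :
    (0 : ℂ) ≤ ∑ j ∈ Finset.range (k + 1),
      (-1) ^ j * (k.choose j : ℂ) * (m (n + j) / (L : ℂ) ^ (n + j)) := by
  have hs₁pos : 0 < s₁ := hs₁.1.1
  have hLpos : 0 < L := lt_trans (by positivity) hL
  have hreal := riemannHypothesis_iff.mp hRH
  set B : ℝ := ∑ j ∈ Finset.range (k + 1), (k.choose j : ℝ) / L ^ (n + j) with hB
  have hB0 : 0 ≤ B := Finset.sum_nonneg fun j _ => by positivity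
  have hclosed : IsClosed (Set.Ici (0 : ℂ)) := isClosed_Ici
  -- The nonnegative reals are closed in ℂ, so approximation by nonnegative finite sums over zeros
  -- suffices. `B` is the total weight of the errors, and `B + 1` avoids dividing by zero.
  refine (Metric.mem_of_closed' hclosed).mpr fun ε hε => ?_
  obtain ⟨N, z, hz, hb⟩ := exists_zeros_approx_m (n + k) (show 0 < ε / (B + 1) by positivity)
  refine ⟨∑ j ∈ Finset.range (k + 1), (-1) ^ j * (k.choose j : ℂ) *
    ((∑ l, (1 / z l ^ 2) ^ (n + j + 2)) / 2 / (L : ℂ) ^ (n + j)), ?_, ?_⟩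
  · have hterm : ∀ l, ∃ lam : ℝ, 0 ≤ lam ∧ lam ≤ L ∧ 1 / z l ^ 2 = (lam : ℂ) := by
      intro l
      obtain ⟨hzl, hz0⟩ := hz l
      have him := hreal _ hzl
      have hzre : z l = ((z l).re : ℂ) := Complex.ext rfl (by simp [him])
      have hle : s₁ ≤ |(z l).re| := by
        refine hs₁.2 ⟨abs_pos.mpr (re_ne_zero_of_Xi_eq_zero hzl), ?_⟩
        rcases abs_choice (z l).re with h | h
        · exact ⟨z l, hzl, h.symm⟩
        · exact ⟨-z l, (Xi_neg _).trans hzl, by rw [h, Complex.neg_re]⟩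
      refine ⟨1 / (z l).re ^ 2, by positivity, ?_, ?_⟩
      · refine le_trans ?_ hL.le
        rw [one_div, ← sq_abs (z l).re]
        gcongr
      · rw [hzre]
        push_cast
        simp
    choose lam hlam0 hlamL hlam using hterm
    have hval : ∑ j ∈ Finset.range (k + 1), (-1) ^ j * (k.choose j : ℂ) *
        ((∑ l, (1 / z l ^ 2) ^ (n + j + 2)) / 2 / (L : ℂ) ^ (n + j)) =
        ((∑ l, lam l ^ 2 / 2 * (lam l / L) ^ n * (1 - lam l / L) ^ k : ℝ) : ℂ) := by
      simp_rw [hlam, Finset.sum_div, Finset.mul_sum]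
      rw [Finset.sum_comm]
      push_cast
      refine Finset.sum_congr rfl fun l _ => ?_
      rw [sub_eq_neg_add, add_pow, Finset.mul_sum]
      refine Finset.sum_congr rfl fun j _ => ?_
      have hLc : (L : ℂ) ≠ 0 := by exact_mod_cast hLpos.ne'
      rw [neg_pow ((lam l : ℂ) / L), one_pow, div_pow, div_pow]
      field_simp
      ring
    rw [Set.mem_Ici, hval]
    refine Complex.zero_le_real.mpr (Finset.sum_nonneg fun l _ => ?_)
    have h1 : 0 ≤ 1 - lam l / L := by
      rw [sub_nonneg, div_le_one hLpos]
      exact hlamL l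
    have := hlam0 l
    positivity
  · rw [dist_eq_norm, ← Finset.sum_sub_distrib]
    calc _ ≤ ∑ j ∈ Finset.range (k + 1), (k.choose j : ℝ) / L ^ (n + j) * (ε / (B + 1)) := by
          refine norm_sum_le_of_le _ fun j hj => ?_
          have hj' : j ≤ k := Nat.lt_succ_iff.mp (Finset.mem_range.mp hj)
          have h := hb (n + j) (by omega)
          rw [← mul_sub, ← sub_div, norm_mul, norm_mul, norm_div, norm_pow, norm_pow, norm_neg,
            norm_one, one_pow, one_mul, Complex.norm_natCast, Complex.norm_real,
            Real.norm_of_nonneg hLpos.le, mul_div_assoc', div_mul_eq_mul_div]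
          gcongr
      _ = B * (ε / (B + 1)) := by rw [← Finset.sum_mul]
      _ < ε := by
          rw [mul_div_assoc', div_lt_iff₀ (by positivity)]
          nlinarith

/-! ### Hausdorff's moment problem by Bernstein polynomials. -/

open Polynomial in
/-- The linear functional on polynomials that takes the value `c n` at `X ^ n`. -/
noncomputable def momentFunctional {R : Type*} [CommRing R] (c : ℕ → R) : R[X] →ₗ[R] R :=
  Polynomial.lsum fun n => c n • LinearMap.id

open Polynomial in
theorem momentFunctional_X_pow {R : Type*} [CommRing R] (c : ℕ → R) (n : ℕ) :
    momentFunctional c (X ^ n) = c n := by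
  rw [momentFunctional, X_pow_eq_monomial, lsum_apply, sum_monomial_index] <;> simp

/-- The signed iterated differences `∑_{j ≤ k} (-1)^j C(k,j) c_{n+j}`. -/
def iteratedDifference (c : ℕ → ℝ) (k n : ℕ) : ℝ :=
  ∑ j ∈ Finset.range (k + 1), (-1) ^ j * (k.choose j : ℝ) * c (n + j)

/-- The value of the moment functional at a Bernstein polynomial. -/
def bernsteinMoment (c : ℕ → ℝ) (N ν : ℕ) : ℝ :=
  (N.choose ν : ℝ) * iteratedDifference c (N - ν) ν

open Polynomial in
theorem momentFunctional_bernsteinPolynomial (c : ℕ → ℝ) (N ν : ℕ) :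
    momentFunctional c (bernsteinPolynomial ℝ N ν) = bernsteinMoment c N ν := by
  have h : bernsteinPolynomial ℝ N ν = ∑ j ∈ Finset.range (N - ν + 1),
      ((N.choose ν : ℝ) * ((-1) ^ j * ((N - ν).choose j : ℝ))) • (X : ℝ[X]) ^ (ν + j) := by
    rw [bernsteinPolynomial, sub_eq_neg_add, add_pow, Finset.mul_sum]
    refine Finset.sum_congr rfl fun j _ => ?_
    rw [smul_eq_C_mul, neg_pow (X : ℝ[X])]
    simp only [C_mul, C_pow, C_neg, C_1, one_pow, map_natCast]
    ring
  rw [h, map_sum, bernsteinMoment, iteratedDifference, Finset.mul_sum]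
  refine Finset.sum_congr rfl fun j _ => ?_
  rw [map_smul, momentFunctional_X_pow, smul_eq_mul]
  ring

theorem sum_bernsteinMoment (c : ℕ → ℝ) (N : ℕ) :
    ∑ ν ∈ Finset.range (N + 1), bernsteinMoment c N ν = c 0 := by
  simp_rw [← momentFunctional_bernsteinPolynomial]
  rw [← map_sum, bernsteinPolynomial.sum, ← pow_zero, momentFunctional_X_pow]

theorem bernsteinMoment_succ_succ (c : ℕ → ℝ) (N ν : ℕ) :
    ((ν : ℝ) + 1) / (N + 1) * bernsteinMoment c (N + 1) (ν + 1) =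
      bernsteinMoment (fun n => c (n + 1)) N ν := by
  have h : ((N : ℝ) + 1) * N.choose ν = (N + 1).choose (ν + 1) * ((ν : ℝ) + 1) := by
    exact_mod_cast Nat.add_one_mul_choose_eq N ν
  have hd : iteratedDifference c (N - ν) (ν + 1) =
      iteratedDifference (fun n => c (n + 1)) (N - ν) ν := by
    simp only [iteratedDifference, add_right_comm ν 1]
  rw [bernsteinMoment, bernsteinMoment, Nat.add_sub_add_right, hd, ← mul_assoc]
  congr 1
  field_simp
  linarith

-- Induction on `m`: by `bernsteinMoment_succ_succ` one factor of the node is absorbed into a shift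
-- of `c`, at the cost of nodes `(ν+1)/(N+1)` in place of `ν/N`.
open Filter in
theorem tendsto_sum_pow_mul_bernsteinMoment (m : ℕ) {c : ℕ → ℝ}
    (hc : ∀ k n, 0 ≤ iteratedDifference c k n) :
    Tendsto (fun N : ℕ => ∑ ν ∈ Finset.range (N + 1),
      ((ν : ℝ) / N) ^ m * bernsteinMoment c N ν) atTop (nhds (c m)) := by
  induction m generalizing c with
  | zero => simp [sum_bernsteinMoment]
  | succ m ih =>
    have hc' : ∀ k n, 0 ≤ iteratedDifference (fun n => c (n + 1)) k n := by
      intro k n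
      have h := hc k (n + 1)
      simpa only [iteratedDifference, add_right_comm n 1] using h
    have hβ : ∀ N ν, 0 ≤ bernsteinMoment (fun n => c (n + 1)) N ν := fun N ν =>
      mul_nonneg (Nat.cast_nonneg _) (hc' _ _)
    have h1 := ih hc'
    rw [← tendsto_add_atTop_iff_nat 1]
    have h2 : ∀ N : ℕ, ∑ ν ∈ Finset.range (N + 1 + 1),
        ((ν : ℝ) / (N + 1 : ℕ)) ^ (m + 1) * bernsteinMoment c (N + 1) ν =
        ∑ ν ∈ Finset.range (N + 1),
          (((ν : ℝ) + 1) / (N + 1)) ^ m * bernsteinMoment (fun n => c (n + 1)) N ν := by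
      intro N
      rw [Finset.sum_range_succ']
      simp only [Nat.cast_zero, zero_div, zero_pow (Nat.succ_ne_zero m), zero_mul, add_zero]
      refine Finset.sum_congr rfl fun ν _ => ?_
      rw [← bernsteinMoment_succ_succ]
      push_cast
      ring
    simp_rw [h2]
    have h3 : Tendsto (fun N : ℕ => (m : ℝ) / ((N : ℝ) + 1) * c 1) atTop (nhds 0) := by
      have := ((tendsto_one_div_add_atTop_nhds_zero_nat (𝕜 := ℝ)).const_mul (m : ℝ)).mul_const
        (c 1)
      simpa [div_eq_mul_inv] using this
    -- Both nodes lie in `[0,1]` and differ by at most `1/(N+1)`, so their `m`-th powers differ by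
    -- at most `m/(N+1)`; the nonnegative weights sum to `c 1`.
    refine tendsto_of_tendsto_of_dist h1 (squeeze_zero' (Eventually.of_forall fun _ => dist_nonneg)
      ?_ h3)
    filter_upwards [eventually_gt_atTop 0] with N hN
    have hN' : (0 : ℝ) < N := by exact_mod_cast hN
    have hs := sum_bernsteinMoment (fun n => c (n + 1)) N
    simp only [zero_add] at hs
    rw [dist_eq_norm, ← Finset.sum_sub_distrib, ← hs, Finset.mul_sum]
    refine norm_sum_le_of_le _ fun ν hν => ?_
    have hνN : (ν : ℝ) ≤ N := by exact_mod_cast Nat.lt_succ_iff.mp (Finset.mem_range.mp hν)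
    have hν0 : (0 : ℝ) ≤ ν := ν.cast_nonneg
    rw [← sub_mul, norm_mul, Real.norm_of_nonneg (hβ N ν), Real.norm_eq_abs]
    refine mul_le_mul_of_nonneg_right ?_ (hβ N ν)
    refine (abs_pow_sub_pow_le _ _ m).trans ?_
    have e1 : |(ν : ℝ) / N - ((ν : ℝ) + 1) / (N + 1)| ≤ 1 / (N + 1) := by
      have : (ν : ℝ) / N - ((ν : ℝ) + 1) / (N + 1) = -((N - ν) / N / (N + 1)) := by
        field_simp
        ring
      rw [this, abs_neg, abs_of_nonneg (div_nonneg (div_nonneg (by linarith) hN'.le)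
        (by linarith))]
      gcongr
      rw [div_le_one hN']
      linarith
    have e2 : max |(ν : ℝ) / N| |((ν : ℝ) + 1) / (N + 1)| ^ (m - 1) ≤ 1 := by
      refine pow_le_one₀ (le_max_of_le_left (abs_nonneg _)) (max_le ?_ ?_)
      · rw [abs_of_nonneg (by positivity), div_le_one hN']
        exact hνN
      · rw [abs_of_nonneg (by positivity), div_le_one (by positivity)]
        linarith
    calc _ ≤ 1 / ((N : ℝ) + 1) * m * 1 := by gcongr
      _ = m / ((N : ℝ) + 1) := by ring

open Filter Polynomial in
theorem tendsto_sum_eval_mul_bernsteinMoment {c : ℕ → ℝ}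
    (hc : ∀ k n, 0 ≤ iteratedDifference c k n) (p : ℂ[X]) :
    Tendsto (fun N : ℕ => ∑ ν ∈ Finset.range (N + 1),
      p.eval ((((ν : ℝ) / N : ℝ)) : ℂ) * (bernsteinMoment c N ν : ℂ)) atTop
      (nhds (momentFunctional (fun n => (c n : ℂ)) p)) := by
  induction p using Polynomial.induction_on' with
  | add p q hp hq =>
    rw [map_add]
    refine (hp.add hq).congr fun N => ?_
    rw [← Finset.sum_add_distrib]
    refine Finset.sum_congr rfl fun ν _ => ?_
    rw [eval_add, add_mul]
  | monomial n b =>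
    have h := ((Complex.continuous_ofReal.tendsto _).comp
      (tendsto_sum_pow_mul_bernsteinMoment n hc)).const_mul b
    rw [← mul_one b, ← smul_eq_mul b 1, ← smul_monomial, map_smul, ← X_pow_eq_monomial,
      momentFunctional_X_pow, smul_eq_mul]
    refine h.congr fun N => ?_
    simp only [Function.comp_apply, Complex.ofReal_sum, Finset.mul_sum]
    refine Finset.sum_congr rfl fun ν _ => ?_
    simp
    ring

-- The Bernstein sums have nonnegative weights of total mass `c 0` and nodes in `[0,1]`; the bound
-- passes to the limit.
open Polynomial in
theorem norm_momentFunctional_le {c : ℕ → ℝ} (hc : ∀ k n, 0 ≤ iteratedDifference c k n)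
    (p : ℂ[X]) {B : ℝ} (hB : ∀ x : ℝ, 0 ≤ x → x ≤ 1 → ‖p.eval (x : ℂ)‖ ≤ B) :
    ‖momentFunctional (fun n => (c n : ℂ)) p‖ ≤ c 0 * B := by
  refine le_of_tendsto (tendsto_sum_eval_mul_bernsteinMoment hc p).norm
    (Filter.Eventually.of_forall fun N => ?_)
  rw [← sum_bernsteinMoment c N, Finset.sum_mul]
  refine norm_sum_le_of_le _ fun ν hν => ?_
  have hβ : 0 ≤ bernsteinMoment c N ν := mul_nonneg (Nat.cast_nonneg _) (hc _ _)
  rw [norm_mul, Complex.norm_real, Real.norm_of_nonneg hβ, mul_comm]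
  refine mul_le_mul_of_nonneg_left (hB _ (by positivity) ?_) hβ
  refine div_le_one_of_le₀ ?_ (Nat.cast_nonneg _)
  exact_mod_cast Nat.lt_succ_iff.mp (Finset.mem_range.mp hν)

open Polynomial unitInterval in
/-- A completely monotone sequence is the moment sequence of a continuous functional on the
continuous functions on the unit interval. -/
theorem exists_functional_of_completelyMonotone {c : ℕ → ℝ}
    (hc : ∀ k n, 0 ≤ iteratedDifference c k n) :
    ∃ T : C(I, ℂ) →L[ℂ] ℂ, ∀ n, T ((⟨fun x : I => ((x : ℝ) : ℂ), by fun_prop⟩ : C(I, ℂ)) ^ n) =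
      c n := by
  set u : C(I, ℂ) := ⟨fun x : I => ((x : ℝ) : ℂ), by fun_prop⟩ with hu
  let φ : ℂ[X] →ₗ[ℂ] C(I, ℂ) := (aeval u).toLinearMap
  let Λ : ℂ[X] →ₗ[ℂ] ℂ := momentFunctional fun n => (c n : ℂ)
  have hφ : ∀ p (x : I), φ p x = p.eval ((x : ℝ) : ℂ) := by
    intro p x
    have h := Polynomial.aeval_algHom_apply (ContinuousMap.evalAlgHom ℂ ℂ x) u p
    rw [← Polynomial.coe_aeval_eq_eval]
    exact h.symm
  have hb : ∀ p, ‖Λ p‖ ≤ c 0 * ‖φ p‖ := fun p =>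
    norm_momentFunctional_le hc p fun x hx0 hx1 => by
      rw [← hφ p ⟨x, hx0, hx1⟩]
      exact ContinuousMap.norm_coe_le_norm _ _
  -- The sup-norm bound makes `Λ` factor through the polynomial functions on `[0,1]`; Hahn-Banach
  -- then extends it to all of `C(I, ℂ)`.
  have hker : LinearMap.ker φ ≤ LinearMap.ker Λ := by
    intro p hp
    rw [LinearMap.mem_ker] at hp ⊢
    have := hb p
    rw [hp, norm_zero, mul_zero] at this
    exact norm_le_zero_iff.mp this
  let f : LinearMap.range φ →ₗ[ℂ] ℂ :=
    ((LinearMap.ker φ).liftQ Λ hker) ∘ₗ φ.quotKerEquivRange.symm.toLinearMap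
  have hf : ∀ p, f ⟨φ p, LinearMap.mem_range_self φ p⟩ = Λ p := by
    intro p
    change (LinearMap.ker φ).liftQ Λ hker (φ.quotKerEquivRange.symm _) = _
    rw [LinearMap.quotKerEquivRange_symm_apply_image]
    simp
  obtain ⟨T, hT, -⟩ := exists_extension_norm_eq (LinearMap.range φ)
    (f.mkContinuous (c 0) (by
      rintro ⟨_, p, rfl⟩
      exact (congrArg norm (hf p)).le.trans (hb p)))
  refine ⟨T, fun n => ?_⟩
  have h1 : φ (X ^ n) = u ^ n := by simp [φ]
  have h2 := hT ⟨φ (X ^ n), LinearMap.mem_range_self φ _⟩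
  rw [LinearMap.mkContinuous_apply, hf, momentFunctional_X_pow] at h2
  rw [← h1]
  exact h2

open unitInterval in
/-- The generating function of a completely monotone sequence extends to the complement of the
half-line `[1, ∞)`. -/
theorem exists_extension_of_completelyMonotone {c : ℕ → ℝ}
    (hc : ∀ k n, 0 ≤ iteratedDifference c k n) :
    ∃ F : ℂ → ℂ, (∀ w : ℂ, (∀ x : ℝ, 0 ≤ x → x ≤ 1 → w * x ≠ 1) → DifferentiableAt ℂ F w) ∧
      ∀ w : ℂ, ‖w‖ < 1 → HasSum (fun n => (c n : ℂ) * w ^ n) (F w) := by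
  obtain ⟨T, hT⟩ := exists_functional_of_completelyMonotone hc
  set u : C(I, ℂ) := ⟨fun x : I => ((x : ℝ) : ℂ), by fun_prop⟩ with hu
  -- `1 - w x` is a unit of `C(I, ℂ)` exactly when `w x ≠ 1` on `[0,1]`, and inversion is
  -- differentiable at units; for `|w| < 1` the inverse is a geometric series.
  refine ⟨fun w => T (Ring.inverse (1 - w • u)), fun w hw => ?_, fun w hw => ?_⟩
  · have hunit : IsUnit (1 - w • u) := by
      rw [ContinuousMap.isUnit_iff_forall_ne_zero]
      intro x h
      refine hw x x.2.1 x.2.2 ?_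
      have h' : 1 - w * ((x : ℝ) : ℂ) = 0 := h
      exact (sub_eq_zero.mp h').symm
    have h1 : DifferentiableAt ℂ (fun w : ℂ => 1 - w • u) w := by fun_prop
    have h2 : DifferentiableAt ℂ (fun w : ℂ => Ring.inverse (1 - w • u)) w :=
      DifferentiableAt.comp (f := fun w : ℂ => 1 - w • u) (g := Ring.inverse) w
        (differentiableAt_inverse hunit) h1
    exact T.differentiableAt.comp w h2
  · have hun : ‖u‖ ≤ 1 := by
      rw [ContinuousMap.norm_le _ zero_le_one]
      intro x
      change ‖((x : ℝ) : ℂ)‖ ≤ 1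
      rw [Complex.norm_real, Real.norm_of_nonneg x.2.1]
      exact x.2.2
    have hlt : ‖w • u‖ < 1 := by
      rw [norm_smul]
      exact (mul_le_of_le_one_right (norm_nonneg _) hun).trans_lt hw
    have h := T.hasSum (hasSum_geom_series_inverse (w • u) hlt)
    convert! h using 2 with n
    rw [smul_pow, map_smul, hT, smul_eq_mul, mul_comm]

/-! ### Continuation of Ξ'/Ξ and the converse implication. -/

/-- A nonzero entire function that satisfies a linear differential equation with analytic
coefficient near a point does not vanish at that point. -/
theorem ne_zero_of_deriv_eventuallyEq_mul {f H : ℂ → ℂ} {z : ℂ} (hf : Differentiable ℂ f)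
    (hf0 : ∃ x, f x ≠ 0) (hH : AnalyticAt ℂ H z) (h : deriv f =ᶠ[nhds z] H * f) : f z ≠ 0 := by
  intro hz
  have hfa : AnalyticAt ℂ f z := hf.analyticAt z
  have h1 : analyticOrderAt f z ≠ ⊤ := by
    obtain ⟨x, hx⟩ := hf0
    refine AnalyticOnNhd.analyticOrderAt_ne_top_of_isPreconnected (U := Set.univ) (x := x)
      (fun y _ => hf.analyticAt y) isPreconnected_univ trivial trivial ?_
    rw [analyticOrderAt_eq_zero.mpr (Or.inr hx)]
    exact ENat.zero_ne_top
  have h2 := hfa.analyticOrderAt_deriv_add_one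
  simp only [hz, sub_zero] at h2
  -- At a zero of finite order, differentiation lowers the order by one, whereas multiplication by
  -- `H` cannot lower it.
  have h3 : analyticOrderAt f z ≤ analyticOrderAt (deriv f) z := by
    rw [analyticOrderAt_congr h, analyticOrderAt_mul hH hfa]
    exact le_add_self
  rw [← h2] at h3
  have h4 : analyticOrderAt (deriv f) z ≠ ⊤ := by
    intro htop
    rw [htop, top_add] at h2
    exact h1 h2.symm
  exact (ENat.add_one_le_iff h4).mp h3 |>.false

theorem taylorCoeff_logDerivXi_even (n : ℕ) : taylorCoeff logDerivXi (2 * n) = 0 := by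
  have hodd : (fun s => logDerivXi (-s)) = fun s => -logDerivXi s := by
    ext s
    have h0 : (fun s => Xi (-s)) = Xi := funext Xi_neg
    have h1 := deriv_comp_neg Xi s
    rw [h0] at h1
    rw [logDerivXi, logDerivXi, Xi_neg, h1, neg_div, neg_neg]
  have h := iteratedDeriv_comp_neg (2 * n) logDerivXi 0
  rw [hodd, iteratedDeriv_fun_neg, neg_zero, pow_mul] at h
  simp only [even_two, Even.neg_pow, one_pow, one_smul] at h
  rw [taylorCoeff, self_eq_neg.mp h.symm, zero_div]

/-- The domain of those `s` for which `L s²` avoids the half-line `[1, ∞)`. -/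
def slitDomain (L : ℝ) : Set ℂ := {s | 1 - L * s ^ 2 ∈ Complex.slitPlane}

theorem isOpen_slitDomain (L : ℝ) : IsOpen (slitDomain L) :=
  Complex.isOpen_slitPlane.preimage (by fun_prop : Continuous fun s : ℂ => 1 - (L : ℂ) * s ^ 2)

theorem zero_mem_slitDomain (L : ℝ) : (0 : ℂ) ∈ slitDomain L := by
  simp [slitDomain]

theorem isPreconnected_slitDomain (L : ℝ) : IsPreconnected (slitDomain L) := by
  have hstar : StarConvex ℝ (0 : ℂ) (slitDomain L) := by
    intro s hs p q hp hq hpq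
    -- `1 - L(qs)² = (1 - q²)·1 + q²(1 - L s²)`, so star-convexity about 1 pulls back.
    have h := Complex.starConvex_one_slitPlane hs (a := 1 - q ^ 2) (b := q ^ 2)
      (by nlinarith) (by positivity) (by ring)
    change 1 - (L : ℂ) * (p • (0 : ℂ) + q • s) ^ 2 ∈ Complex.slitPlane
    convert! h using 1
    simp only [Complex.real_smul]
    push_cast
    ring
  exact (hstar.isPathConnected (zero_mem_slitDomain L)).isConnected.isPreconnected

theorem im_eq_zero_of_notMem_slitDomain {L : ℝ} (hL : 0 < L) {z : ℂ} (hz : z ∉ slitDomain L) :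
    z.im = 0 := by
  rw [slitDomain, Set.mem_ofPred_eq, Complex.mem_slitPlane_iff, not_or, not_lt, not_not] at hz
  have hre : (1 - (L : ℂ) * z ^ 2).re = 1 - L * (z.re ^ 2 - z.im ^ 2) := by
    simp [pow_two]
  have him : (1 - (L : ℂ) * z ^ 2).im = -(L * (2 * (z.re * z.im))) := by
    simp only [pow_two, Complex.sub_im, Complex.one_im, Complex.mul_im, Complex.mul_re,
      Complex.ofReal_re, Complex.ofReal_im]
    ring
  rw [hre, him] at hz
  obtain ⟨h1, h2⟩ := hz
  have h3 : z.re * z.im = 0 := by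
    have := mul_eq_zero.mp (neg_eq_zero.mp h2)
    rcases this with h | h
    · exact absurd h hL.ne'
    · linarith
  rcases mul_eq_zero.mp h3 with h | h
  · rw [h] at h1
    nlinarith [mul_nonneg hL.le (sq_nonneg z.im)]
  · exact h

theorem riemannHypothesis_of_moment_nonneg {L : ℝ} (hL : 0 < L)
    (h : ∀ n k : ℕ, (0 : ℂ) ≤ ∑ j ∈ Finset.range (k + 1),
      (-1) ^ j * (k.choose j : ℂ) * (m (n + j) / (L : ℂ) ^ (n + j))) : RiemannHypothesis := by
  have hLc : (L : ℂ) ≠ 0 := by exact_mod_cast hL.ne'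
  set c : ℕ → ℝ := fun n => (m n / (L : ℂ) ^ n).re with hcdef
  have hcm : ∀ n, (c n : ℂ) = m n / (L : ℂ) ^ n := by
    intro n
    -- The case `k = 0` already makes `m n / L^n` real.
    have h0 := h n 0
    simp only [zero_add, Finset.sum_range_one, pow_zero, Nat.choose_self, Nat.cast_one, one_mul,
      add_zero] at h0
    exact (Complex.eq_re_of_ofReal_le (r := 0) (by simpa using h0)).symm
  have hc : ∀ k n, 0 ≤ iteratedDifference c k n := by
    intro k n
    have h0 := h n k
    simp_rw [← hcm] at h0
    rw [← Complex.zero_le_real, iteratedDifference]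
    push_cast
    exact h0
  obtain ⟨F, hFd, hFs⟩ := exists_extension_of_completelyMonotone hc
  -- The coefficient of `s^(2k+3)` in Ξ'/Ξ is `-2 m_k = -2 c_k L^k`, so `H` sums the odd series,
  -- with the linear term split off.
  set H : ℂ → ℂ := fun s =>
    taylorCoeff logDerivXi 1 * s - 2 * s ^ 3 * F (L * s ^ 2) with hH
  have hHd : DifferentiableOn ℂ H (slitDomain L) := by
    intro s hs
    have hF : DifferentiableAt ℂ F (L * s ^ 2) := by
      refine hFd _ fun x hx0 hx1 hx => ?_
      have hs' : 1 - (L : ℂ) * s ^ 2 ∈ Complex.slitPlane := hs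
      have hx' : (0 : ℝ) < x := by
        refine lt_of_le_of_ne hx0 fun h => ?_
        rw [← h] at hx
        simp at hx
      have hxc : (x : ℂ) ≠ 0 := by exact_mod_cast hx'.ne'
      rw [eq_div_of_mul_eq hxc hx, ← Complex.ofReal_one, ← Complex.ofReal_div,
        ← Complex.ofReal_sub, Complex.ofReal_mem_slitPlane, sub_pos, div_lt_one hx'] at hs'
      linarith
    have hF' : DifferentiableAt ℂ (fun s : ℂ => F (L * s ^ 2)) s :=
      DifferentiableAt.comp (f := fun s : ℂ => (L : ℂ) * s ^ 2) (g := F) s hF (by fun_prop)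
    exact DifferentiableAt.differentiableWithinAt (by fun_prop)
  have hHa : AnalyticOnNhd ℂ H (slitDomain L) := hHd.analyticOnNhd (isOpen_slitDomain L)
  have hXa : AnalyticOnNhd ℂ Xi (slitDomain L) := fun s _ => differentiable_Xi.analyticAt s
  have hlocal : ∀ᶠ s in nhds (0 : ℂ), logDerivXi s = H s := by
    have hlt : ∀ᶠ s in nhds (0 : ℂ), ‖(L : ℂ) * s ^ 2‖ < 1 := by
      have hcont : ContinuousAt (fun s : ℂ => ‖(L : ℂ) * s ^ 2‖) 0 := by fun_prop
      exact hcont.eventually_lt continuousAt_const (by simp)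
    filter_upwards [eventually_hasSum_taylorCoeff analyticAt_logDerivXi, hlt] with s hs hsL
    refine hs.unique ?_
    rw [← zero_add (H s)]
    refine HasSum.even_add_odd ?_ ?_
    · simp only [taylorCoeff_logDerivXi_even, zero_mul]
      exact hasSum_zero
    · rw [← hasSum_nat_add_iff' 1]
      have h1 := (hFs _ hsL).mul_left (-2 * s ^ 3)
      convert! h1 using 1
      · ext k
        rw [hcm, mul_pow, show 2 * (k + 1) + 1 = 2 * k + 3 by ring, m_eq_taylorCoeff]
        field_simp
        ring
      · simp [hH]
  -- The identity is continued as `Ξ' = H Ξ` rather than `Ξ'/Ξ = H`, since zeros of Ξ in the domain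
  -- are not yet excluded.
  have hode : Set.EqOn (deriv Xi) (H * Xi) (slitDomain L) := by
    refine AnalyticOnNhd.eqOn_of_preconnected_of_eventuallyEq hXa.deriv (hHa.mul hXa)
      (isPreconnected_slitDomain L) (zero_mem_slitDomain L) ?_
    filter_upwards [hlocal, eventually_Xi_ne_zero] with s hs hne
    rw [Pi.mul_apply, ← hs, logDerivXi, div_mul_cancel₀ _ hne]
  refine riemannHypothesis_iff.mpr fun z hz => ?_
  by_contra him
  have hzmem : z ∈ slitDomain L := by
    by_contra hno
    exact him (im_eq_zero_of_notMem_slitDomain hL hno)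
  exact ne_zero_of_deriv_eventuallyEq_mul differentiable_Xi ⟨0, Xi_zero_ne⟩ (hHa z hzmem)
    (hode.eventuallyEq_of_mem ((isOpen_slitDomain L).mem_nhds hzmem)) hz

end RiemannXi

theorem mainTheorem4 :
    (∀ n : ℕ, 0 < RiemannXi.a n) ∧
    (∀ s : ℂ, HasSum (fun n : ℕ => (RiemannXi.a n : ℂ) * s ^ (2 * n))
      (RiemannXi.xi (1 / 2 + s))) ∧
    (∀ n : ℕ, RiemannXi.m n = (-1) ^ n * ((RiemannXi.momentMatrix n).det : ℂ)) ∧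
    (∀ n : ℕ, (-1) ^ n * RiemannXi.m n =
      ((RiemannXi.a 1 * RiemannXi.a (n + 1) / RiemannXi.a 0 ^ 2
        - ((n : ℝ) + 2) * RiemannXi.a (n + 2) / RiemannXi.a 0 : ℝ) : ℂ)
      - ∑ k ∈ Finset.range n,
          (-1) ^ k * RiemannXi.m k * (RiemannXi.a (n - k) : ℂ) / (RiemannXi.a 0 : ℂ)) ∧
    ∃ s₁ : ℝ, IsLeast RiemannXi.positiveZeroRealParts s₁ ∧
      (RiemannHypothesis ↔
        ∃ L : ℝ, 0 < L ∧ (s₁ ^ 2)⁻¹ < L ∧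
          ∀ n k : ℕ, (0 : ℂ) ≤ ∑ j ∈ Finset.range (k + 1),
            (-1) ^ j * (k.choose j : ℂ) * (RiemannXi.m (n + j) / (L : ℂ) ^ (n + j))) := by
  refine ⟨RiemannXi.a_pos, RiemannXi.hasSum_xi, RiemannXi.m_eq_det, RiemannXi.m_recursion, ?_⟩
  obtain ⟨s₁, hs₁⟩ := RiemannXi.exists_isLeast_positiveZeroRealParts
  refine ⟨s₁, hs₁, fun hRH => ?_, fun ⟨L, hL, _, h⟩ =>
    RiemannXi.riemannHypothesis_of_moment_nonneg hL h⟩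
  have hlt : (s₁ ^ 2)⁻¹ < (s₁ ^ 2)⁻¹ + 1 := lt_add_one _
  exact ⟨(s₁ ^ 2)⁻¹ + 1, by positivity, hlt,
    RiemannXi.moment_nonneg_of_riemannHypothesis hRH hs₁ hlt⟩
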